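/- Let $\ell,m,n\ge 0$ be integers, let $P_k$ be the path on vertices $1,\dots,k$, and orient every labelled graph canonically (from lower to higher label) unless said otherwise. **Labellings.** $P_k$ is labelled $1,\dots,k$ from one leaf to the other and drawn on a line, with canonical orientation $\mathcal O_k$. The grid $P_\ell\square P_m$, with its standard drawing in the plane, has the boustrophedon labelling: $(p,q)$ has label $2s\ell+p$ if $q=2s+1$ and $2s\ell-p+1$ if $q=2s$; its canonical orientation is $\mathcal O_{\ell,m}$. The boustrophedon label of $(p,q,r)$ in $P_\ell\square P_m\square P_n$ is $2t\ell m+2s\ell+p$ if $q=2s+1,\ r=2t+1$; $2t\ell m+2s\ell-p+1$ if $q=2s,\ r=2t+1$; $2t\ell m-2s\ell-p+1$ if $q=2s+1,\ r=2t$; $2t\ell m-2s\ell+p$ if $q=2s,\ r=2t$. **Oriented product.** For labelled oriented graphs $(G_1,\mathcal O_1)$, $(G_2,\mathcal O_2)$, in the oriented product on $G_1\square G_2$ the edges inside copies of $G_2$ are oriented as in $\mathcal O_2$, and the edges of the copy of $G_1$ at $v\in V(G_2)$ are oriented as in $\mathcal O_1$ if the label of $v$ is odd, and oppositely if it is even.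 **Partition function.** Let $G_1,G_2$ be simple labelled plane graphs and let $P=G_1\square G_2$ have vertex weights $x(w)$ and edge weights $a_e$ in a commutative ring. A configuration $C$ is a set of vertex-disjoint directed even loops of $P$ (a doubled edge counts as a loop of length $2$); vertices on no loop are isolated. For a directed cycle $d$ in $G_i$, possibly with parallel edges, let $\chi(d)$ be the number of vertices of $G_i$ enclosed by $d$, and put $\operatorname{sgn}(d)=(-1)^{\chi(d)}$ if $d$ has odd length and is directed clockwise, $\operatorname{sgn}(d)=(-1)^{\chi(d)+1}$ otherwise. For a multiset $\mathcal D$ of directed cycles let $\operatorname{sgn}(\mathcal D)=\prod_{d\in\mathcal D}\operatorname{sgn}(d)$. For a loop $c$ of $P$ fix a decomposition $\mathcal D_i$ of the projection of $c$ to $G_i$ (a directed closed trail, with parallel edges) into directed cycles that inherit their direction from the trail, and let $e_1$ be the number of edges of $c$ (with multiplicity) lying in copies of $G_1$ at vertices of $G_2$ with even label. Put $$w(c)=-(-1)^{e_1}\operatorname{sgn}(\mathcal D_1)\operatorname{sgn}(\mathcal D_2)\prod_{e\in c}a_e,\qquad \mathcal Z_P=\sum_{C}\ \prod_{c\in C}w(c)\prod_{v\text{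 isolated in }C}x(v).$$ **Claim.** Identify the vertices of $(P_\ell\square P_m)\square P_n$ and of $P_\ell\square(P_m\square P_n)$ via $((p,q),r)\leftrightarrow(p,(q,r))$. Then the oriented Cartesian product of $(P_\ell\square P_m,\mathcal O_{\ell,m})$ with $(P_n,\mathcal O_n)$ and that of $(P_\ell,\mathcal O_\ell)$ with $(P_m\square P_n,\mathcal O_{m,n})$ both carry the canonical orientation given by the boustrophedon labelling of $P_\ell\square P_m\square P_n$, and, for all vertex and edge weights, the partition function of the monopole-dimer model on the first product equals the partition function of the monopole-dimer model on the second: $$\mathcal Z_{(P_\ell\square P_m)\square P_n}=\mathcal Z_{P_\ell\square(P_m\square P_n)}.$$ -/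

import Mathlib

noncomputable section

namespace MonopoleDimer

/-! ## Plane graphs with a natural labelling -/

/-- A simple plane graph on the finite vertex set `V`, drawn in `ℝ²` with straight edges, together
with a natural labelling of its vertices by `1, …, |V|`. The drawing is a planar embedding: vertices
are distinct points, no edge passes through a further vertex, and two different edges meet at
most in a common end. -/
structure PlaneGraph (V : Type*) [Fintype V] where
  graph : SimpleGraph V
  label : V → ℕ
  label_bijOn : Set.BijOn label Set.univ (Set.Icc 1 (Fintype.card V))
  pos : V → ℝ × ℝ
  pos_injective : Function.Injective pos
  vertex_mem_segment : ∀ u v w, graph.Adj u v → pos w ∈ segment ℝ (pos u) (pos v) → w = u ∨ w = v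
  segments_meet : ∀ u v u' v', graph.Adj u v → graph.Adj u' v' → s(u, v) ≠ s(u', v') →
    ∀ z ∈ segment ℝ (pos u) (pos v), z ∈ segment ℝ (pos u') (pos v') →
      ∃ w, z = pos w ∧ (w = u ∨ w = v) ∧ (w = u' ∨ w = v')

section Cycles

variable {V : Type*} [Fintype V] [DecidableEq V]

/-- The arcs traversed by a directed cycle. Throughout, a directed cycle `v₀ → v₁ → ⋯ → v₀` without
repeated vertices (of length at least `2`) is encoded as the cyclic permutation `d` of the vertices
that sends each vertex of the cycle to the next one and fixes all other vertices. -/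
def arcs (d : Equiv.Perm V) : Multiset (V × V) :=
  d.support.val.map fun v => (v, d v)

/-- `D` is a directed cycle decomposition compatible with the directed closed trail whose arcs,
listed with multiplicity (parallel edges), are `T`: the directed cycles in `D` use exactly the arcs
in `T`, each of them in the direction in which it is traversed by the trail. -/
def IsCompatibleDecomposition (T : Multiset (V × V)) (D : Multiset (Equiv.Perm V)) : Prop :=
  (∀ d ∈ D, d.IsCycle) ∧ D.bind arcs = T

namespace PlaneGraph

variable (G : PlaneGraph V)

/-- The closed curve in the plane drawn by the directed cycle `d`. -/
def curve (d : Equiv.Perm V) : Set (ℝ × ℝ) :=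
  ⋃ v ∈ d.support, segment ℝ (G.pos v) (G.pos (d v))

/-- The vertex `v` is enclosed by `d`: it does not lie on the curve of `d`, and it lies in a
bounded component of the complement of that curve. -/
def IsEnclosed (d : Equiv.Perm V) (v : V) : Prop :=
  G.pos v ∉ G.curve d ∧ Bornology.IsBounded (connectedComponentIn (G.curve d)ᶜ (G.pos v))

/-- The number of vertices of the plane graph that are enclosed by `d`. -/
def numEnclosed (d : Equiv.Perm V) : ℕ :=
  {v | G.IsEnclosed d v}.ncard

/-- The directed cycle `d` is directed clockwise: the polygon it draws has negative signed area
(twice the signed area is given by the shoelace formula). -/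
def IsClockwise (d : Equiv.Perm V) : Prop :=
  ∑ v ∈ d.support,
    ((G.pos v).1 * (G.pos (d v)).2 - (G.pos v).2 * (G.pos (d v)).1) < 0

open Classical in
/-- The factor of a directed cycle in the sign of a multiset of directed cycles. -/
def cycleSign (d : Equiv.Perm V) : ℤ :=
  if Odd d.support.card ∧ G.IsClockwise d then (-1) ^ G.numEnclosed d
  else (-1) ^ (G.numEnclosed d + 1)

/-- The sign of an edge-disjoint multiset of directed cycles. -/
def decompositionSign (D : Multiset (Equiv.Perm V)) : ℤ :=
  (D.map G.cycleSign).prod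

/-- The canonical orientation: `u → v` when `uv` is an edge and `u` has the lower label. -/
def canonicalOrientation (u v : V) : Prop :=
  G.graph.Adj u v ∧ G.label u < G.label v

end PlaneGraph

/-! ### Existence of compatible cycle decompositions -/

theorem exists_cycle_arcs_le (M : Multiset (V × V)) (hb : M.map Prod.fst = M.map Prod.snd)
    (hl : ∀ e ∈ M, e.1 ≠ e.2) (hM : M ≠ 0) :
    ∃ d : Equiv.Perm V, d.IsCycle ∧ arcs d ≤ M := by
  classical
  have key : ∀ u : V, ∃ w : V, (u ∈ M.map Prod.fst → (u, w) ∈ M) ∧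
      (u ∉ M.map Prod.fst → w = u) := by
    intro u
    by_cases h : u ∈ M.map Prod.fst
    · obtain ⟨e, he, rfl⟩ := Multiset.mem_map.1 h
      exact ⟨e.2, fun _ => he, fun h' => absurd h h'⟩
    · exact ⟨u, fun h' => absurd h' h, fun _ => rfl⟩
  choose f hf hf' using key
  have hmaps : ∀ u, u ∈ M.map Prod.fst → f u ∈ M.map Prod.fst := by
    intro u hu
    rw [hb]
    exact Multiset.mem_map.2 ⟨_, hf u hu, rfl⟩
  obtain ⟨e, he⟩ := Multiset.exists_mem_of_ne_zero hM
  have hx : e.1 ∈ M.map Prod.fst := Multiset.mem_map.2 ⟨e, he, rfl⟩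
  have hit : ∀ n, f^[n] e.1 ∈ M.map Prod.fst := by
    intro n
    induction n with
    | zero => exact hx
    | succ n ih => rw [Function.iterate_succ_apply']; exact hmaps _ ih
  obtain ⟨a, b, hab, heq⟩ := Finite.exists_ne_map_eq_of_infinite (fun n : ℕ => f^[n] e.1)
  have hper : ∃ y, y ∈ M.map Prod.fst ∧ y ∈ Function.periodicPts f := by
    have main : ∀ a b : ℕ, a < b → f^[a] e.1 = f^[b] e.1 →
        ∃ y, y ∈ M.map Prod.fst ∧ y ∈ Function.periodicPts f := by
      intro a b hlt h
      refine ⟨f^[a] e.1, hit a, b - a, by omega, ?_⟩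
      show f^[b - a] (f^[a] e.1) = f^[a] e.1
      rw [← Function.iterate_add_apply, Nat.sub_add_cancel hlt.le]
      exact h.symm
    rcases lt_or_gt_of_ne hab with h | h
    · exact main a b h heq
    · exact main b a h heq.symm
  obtain ⟨y, hyM, hyp⟩ := hper
  let σ : Equiv.Perm V :=
    Equiv.Perm.ofSubtype (p := fun v => v ∈ Function.periodicPts f)
      ((Function.bijOn_periodicPts f).equiv f)
  have hσ : ∀ v ∈ Function.periodicPts f, σ v = f v := by
    intro v hv
    exact Equiv.Perm.ofSubtype_apply_of_mem _ hv
  have hσ' : ∀ v ∉ Function.periodicPts f, σ v = v := by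
    intro v hv
    exact Equiv.Perm.ofSubtype_apply_of_not_mem _ hv
  have hy : σ y ≠ y := by
    rw [hσ y hyp]
    exact (hl _ (hf y hyM)).symm
  refine ⟨σ.cycleOf y, Equiv.Perm.isCycle_cycleOf σ hy, ?_⟩
  refine (Multiset.le_iff_subset ?_).2 ?_
  · exact Multiset.Nodup.map (fun v w h => (Prod.mk.inj h).1) (Finset.nodup _)
  · intro q hq
    obtain ⟨v, hv, rfl⟩ := Multiset.mem_map.1 hq
    have hv' : v ∈ (σ.cycleOf y).support := hv
    have hsc : σ.SameCycle y v := (Equiv.Perm.mem_support_cycleOf_iff.1 hv').1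
    have hvs : σ v ≠ v :=
      Equiv.Perm.mem_support.1 (hsc.mem_support_iff.1 (Equiv.Perm.mem_support.2 hy))
    rw [hsc.cycleOf_apply]
    have hvp : v ∈ Function.periodicPts f := by
      by_contra h
      exact hvs (hσ' v h)
    have hvf : f v ≠ v := by rwa [← hσ v hvp]
    have hvM : v ∈ M.map Prod.fst := by
      by_contra h
      exact hvf (hf' v h)
    rw [hσ v hvp]
    exact hf v hvM

theorem arcs_fst_eq_snd (d : Equiv.Perm V) :
    (arcs d).map Prod.fst = (arcs d).map Prod.snd := by
  have h : d.support.map d.toEmbedding = d.support := by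
    ext v
    simp only [Finset.mem_map, Equiv.coe_toEmbedding, Equiv.Perm.mem_support]
    constructor
    · rintro ⟨w, hw, rfl⟩
      exact fun h => hw (d.injective h)
    · intro hv
      refine ⟨d.symm v, ?_, by simp⟩
      intro h
      apply hv
      have h2 : v = d.symm v := by simpa using h
      have h3 := congrArg d h2
      simpa using h3
  have h2 := congrArg Finset.val h
  simp only [Finset.map_val] at h2
  simp only [arcs, Multiset.map_map, Function.comp_def]
  simpa using h2.symm

theorem exists_decomposition_of_balanced (M : Multiset (V × V))
    (hb : M.map Prod.fst = M.map Prod.snd) (hl : ∀ e ∈ M, e.1 ≠ e.2) :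
    ∃ D, IsCompatibleDecomposition M D := by
  classical
  induction hn : M.card using Nat.strong_induction_on generalizing M with
  | _ n ih =>
    by_cases hM : M = 0
    · subst hM
      exact ⟨0, by simp, by simp⟩
    · obtain ⟨d, hd, hdM⟩ := exists_cycle_arcs_le M hb hl hM
      obtain ⟨N, rfl⟩ := Multiset.le_iff_exists_add.1 hdM
      have hbN : N.map Prod.fst = N.map Prod.snd := by
        simp only [Multiset.map_add, arcs_fst_eq_snd] at hb
        exact add_left_cancel hb
      have hpos : 0 < (arcs d).card := by
        simp only [arcs, Multiset.card_map]
        exact lt_of_lt_of_le two_pos hd.two_le_card_support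
      obtain ⟨D, hD1, hD2⟩ := ih N.card (by rw [← hn, Multiset.card_add]; omega) N hbN
        (fun e he => hl e (Multiset.mem_add.2 (Or.inr he))) rfl
      refine ⟨d ::ₘ D, ?_, ?_⟩
      · intro c hc
        rcases Multiset.mem_cons.1 hc with rfl | hc
        · exact hd
        · exact hD1 c hc
      · rw [Multiset.cons_bind, hD2]

/-- The arcs of the image of a directed loop `c` of `X` under a map `g` to `V`, leaving out the edges
of `c` that are contracted to a point. For the two coordinate projections of a Cartesian product this
is the projection of the loop to the factor, a directed closed trail in that factor with parallel
edges. -/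
def projArcs {X : Type*} [Fintype X] [DecidableEq X] (g : X → V) (c : Equiv.Perm X) :
    Multiset (V × V) :=
  ((arcs c).filter fun e => g e.1 ≠ g e.2).map (Prod.map g g)

theorem exists_decomposition {X : Type*} [Fintype X] [DecidableEq X] (g : X → V)
    (c : Equiv.Perm X) : ∃ D, IsCompatibleDecomposition (projArcs g c) D := by
  classical
  apply exists_decomposition_of_balanced
  · have h := congrArg (Multiset.map g) (arcs_fst_eq_snd c)
    rw [← Multiset.filter_add_not (fun e : X × X => g e.1 ≠ g e.2) (arcs c)] at h
    simp only [Multiset.map_add, Multiset.map_map, Function.comp_def] at h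
    have h3 : ((arcs c).filter fun e => ¬ g e.1 ≠ g e.2).map (fun e => g e.1) =
        ((arcs c).filter fun e => ¬ g e.1 ≠ g e.2).map (fun e => g e.2) := by
      apply Multiset.map_congr rfl
      intro e he
      exact not_not.1 (Multiset.mem_filter.1 he).2
    rw [h3] at h
    simpa [projArcs, Multiset.map_map, Function.comp_def] using add_right_cancel h
  · intro e he
    obtain ⟨e', he', rfl⟩ := Multiset.mem_map.1 he
    exact (Multiset.mem_filter.1 he').2

/-- A directed cycle decomposition compatible with the projection of the loop `c` along `g`. -/
def projDecomposition {X : Type*} [Fintype X] [DecidableEq X] (g : X → V) (c : Equiv.Perm X) :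
    Multiset (Equiv.Perm V) :=
  (exists_decomposition g c).choose

end Cycles

/-! ## The monopole-dimer model on a Cartesian product of two plane graphs -/

section Product

variable {V W : Type*} [Fintype V] [DecidableEq V] [Fintype W] [DecidableEq W]

/-- A directed loop of even length in the graph `P`; length two is a doubled edge. -/
def IsEvenLoop {X : Type*} [Fintype X] [DecidableEq X] (P : SimpleGraph X)
    (c : Equiv.Perm X) : Prop :=
  c.IsCycle ∧ Even c.support.card ∧ ∀ v ∈ c.support, P.Adj v (c v)

/-- A loop-vertex configuration of `P`, given by its set of directed even loops (including doubled
edges), which are vertex-disjoint; the vertices on no loop are the isolated ones (monopoles). -/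
def IsConfiguration {X : Type*} [Fintype X] [DecidableEq X] (P : SimpleGraph X)
    (C : Finset (Equiv.Perm X)) : Prop :=
  (∀ c ∈ C, IsEvenLoop P c) ∧
    ∀ c ∈ C, ∀ c' ∈ C, c ≠ c' → Disjoint c.support c'.support

/-- The orientation of the oriented Cartesian product of `(A, O₁)` and `(B, O₂)`: the edges of the
second factor keep their orientation, and the edges of the copy of `A` at `b` keep their
orientation if `label b + 1` is even and are reversed otherwise. -/
def orientedProd (B : PlaneGraph W) (O₁ : V → V → Prop) (O₂ : W → W → Prop)
    (u v : V × W) : Prop :=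
  (u.2 = v.2 ∧ ((Even (B.label u.2 + 1) ∧ O₁ u.1 v.1) ∨ (Odd (B.label u.2 + 1) ∧ O₁ v.1 u.1))) ∨
    (u.1 = v.1 ∧ O₂ u.2 v.2)

variable (A : PlaneGraph V) (B : PlaneGraph W)

/-- The number of edges of the loop `c` (a doubled edge counts twice) that lie in a copy of `A` at a
vertex `b` of `B` for which `label b + 1` is odd. -/
def numReversed (c : Equiv.Perm (V × W)) : ℕ :=
  (c.support.filter fun v => v.1 ≠ (c v).1 ∧ Odd (B.label v.2 + 1)).card

/-- The sign of a directed even loop in the Cartesian product of `A` and `B`. -/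
def loopSign (c : Equiv.Perm (V × W)) : ℤ :=
  -((-1) ^ numReversed B c *
    (A.decompositionSign (projDecomposition Prod.fst c) *
      B.decompositionSign (projDecomposition Prod.snd c)))

/-- The weight of a directed even loop, for edge weights `a`. -/
def loopWeight {R : Type*} [CommRing R] (a : Sym2 (V × W) → R) (c : Equiv.Perm (V × W)) : R :=
  (loopSign A B c : R) * ∏ v ∈ c.support, a s(v, c v)

/-- The weight of a configuration, for vertex weights `x` and edge weights `a`. -/
def configWeight {R : Type*} [CommRing R] (x : V × W → R) (a : Sym2 (V × W) → R)
    (C : Finset (Equiv.Perm (V × W))) : R :=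
  (∏ c ∈ C, loopWeight A B a c) * ∏ v ∈ Finset.univ \ C.biUnion Equiv.Perm.support, x v

open Classical in
/-- The (signed) partition function of the monopole-dimer model on the weighted Cartesian product
of `A` and `B`. -/
def partitionFunction {R : Type*} [CommRing R] (x : V × W → R) (a : Sym2 (V × W) → R) : R :=
  ∑ C : Finset (Equiv.Perm (V × W)) with IsConfiguration (A.graph □ B.graph) C,
    configWeight A B x a C

end Product

/-! ## Paths and two-dimensional grids -/

theorem lattice_segment {a b c d : ℤ}
    (h : (a = c ∧ (d = b + 1 ∨ b = d + 1)) ∨ (b = d ∧ (c = a + 1 ∨ a = c + 1)))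
    {z : ℝ × ℝ} (hz : z ∈ segment ℝ ((a : ℝ), (b : ℝ)) ((c : ℝ), (d : ℝ))) :
    z = ((a : ℝ), (b : ℝ)) ∨ z = ((c : ℝ), (d : ℝ)) ∨
      (a = c ∧ z.1 = a ∧ ∃ k : ℤ, (k : ℝ) < z.2 ∧ z.2 < k + 1 ∧
        ((b = k ∧ d = k + 1) ∨ (d = k ∧ b = k + 1))) ∨
      (b = d ∧ z.2 = b ∧ ∃ k : ℤ, (k : ℝ) < z.1 ∧ z.1 < k + 1 ∧
        ((a = k ∧ c = k + 1) ∨ (c = k ∧ a = k + 1))) := by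
  obtain ⟨s, t, hs, ht, hst, rfl⟩ := hz
  have hs' : s = 1 - t := by linarith
  subst hs'
  rcases ht.eq_or_lt with rfl | ht
  · left; ext <;> simp
  rcases hs.eq_or_lt with hs | hs
  · right; left
    have : t = 1 := by linarith
    subst this
    ext <;> simp
  right; right
  rcases h with ⟨rfl, rfl | rfl⟩ | ⟨rfl, rfl | rfl⟩
  · left
    refine ⟨rfl, ?_, b, ?_, ?_, Or.inl ⟨rfl, rfl⟩⟩ <;>
      simp only [Prod.smul_mk, Prod.mk_add_mk, smul_eq_mul] <;> push_cast <;> nlinarith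
  · left
    refine ⟨rfl, ?_, d, ?_, ?_, Or.inr ⟨rfl, rfl⟩⟩ <;>
      simp only [Prod.smul_mk, Prod.mk_add_mk, smul_eq_mul] <;> push_cast <;> nlinarith
  · right
    refine ⟨rfl, ?_, a, ?_, ?_, Or.inl ⟨rfl, rfl⟩⟩ <;>
      simp only [Prod.smul_mk, Prod.mk_add_mk, smul_eq_mul] <;> push_cast <;> nlinarith
  · right
    refine ⟨rfl, ?_, c, ?_, ?_, Or.inr ⟨rfl, rfl⟩⟩ <;>
      simp only [Prod.smul_mk, Prod.mk_add_mk, smul_eq_mul] <;> push_cast <;> nlinarith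

theorem int_not_between {k j : ℤ} {y : ℝ} (h : y = j) (h1 : (k : ℝ) < y) (h2 : y < k + 1) :
    False := by
  subst h
  have h1' : k < j := by exact_mod_cast h1
  have h2' : j < k + 1 := by exact_mod_cast h2
  omega

theorem int_between_unique {k j : ℤ} {y : ℝ} (h1 : (k : ℝ) < y) (h2 : y < k + 1)
    (h3 : (j : ℝ) < y) (h4 : y < j + 1) : k = j := by
  have h5 : (k : ℝ) < j + 1 := by linarith
  have h6 : (j : ℝ) < k + 1 := by linarith
  have h5' : k < j + 1 := by exact_mod_cast h5
  have h6' : j < k + 1 := by exact_mod_cast h6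
  omega

/-- A graph drawn with vertices at distinct lattice points and edges only between neighbouring
lattice points is a plane graph. -/
def latticePlaneGraph {V : Type*} [Fintype V] (G : SimpleGraph V) (label : V → ℕ)
    (hlabel : Set.BijOn label Set.univ (Set.Icc 1 (Fintype.card V)))
    (X Y : V → ℤ) (hinj : ∀ u v, X u = X v → Y u = Y v → u = v)
    (hadj : ∀ u v, G.Adj u v → (X u = X v ∧ (Y v = Y u + 1 ∨ Y u = Y v + 1)) ∨
      (Y u = Y v ∧ (X v = X u + 1 ∨ X u = X v + 1))) : PlaneGraph V where
  graph := G
  label := label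
  label_bijOn := hlabel
  pos v := ((X v : ℝ), (Y v : ℝ))
  pos_injective := by
    intro u v h
    simp only [Prod.mk.injEq, Int.cast_inj] at h
    exact hinj u v h.1 h.2
  vertex_mem_segment := by
    intro u v w huv hw
    have cast_eq : ∀ p q : V, (((X p : ℝ), (Y p : ℝ)) : ℝ × ℝ) = ((X q : ℝ), (Y q : ℝ)) → p = q := by
      intro p q h
      simp only [Prod.mk.injEq, Int.cast_inj] at h
      exact hinj p q h.1 h.2
    rcases lattice_segment (hadj u v huv) hw with h | h | ⟨_, _, k, h1, h2, _⟩ | ⟨_, _, k, h1, h2, _⟩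
    · exact Or.inl (cast_eq _ _ h)
    · exact Or.inr (cast_eq _ _ h)
    · exact (int_not_between rfl h1 h2).elim
    · exact (int_not_between rfl h1 h2).elim
  segments_meet := by
    intro u v u' v' huv huv' hne z hz hz'
    rcases lattice_segment (hadj u v huv) hz with
      h | h | ⟨e, f, k, h1, h2, h3⟩ | ⟨e, f, k, h1, h2, h3⟩ <;>
    rcases lattice_segment (hadj u' v' huv') hz' with
      h' | h' | ⟨e', f', k', h1', h2', h3'⟩ | ⟨e', f', k', h1', h2', h3'⟩
    all_goals first
      | exact (int_not_between (congrArg Prod.fst h) h1' h2').elim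
      | exact (int_not_between (congrArg Prod.snd h) h1' h2').elim
      | exact (int_not_between (congrArg Prod.fst h') h1 h2).elim
      | exact (int_not_between (congrArg Prod.snd h') h1 h2).elim
      | exact (int_not_between f h1' h2').elim
      | skip
    all_goals first
      | (have hw := h.symm.trans h'
         simp only [Prod.mk.injEq, Int.cast_inj] at hw
         have hw' := hinj _ _ hw.1 hw.2
         subst hw'
         exact ⟨_, h, by simp, by simp⟩)
      | skip
    all_goals
      exfalso
      apply hne
      have hk := int_between_unique h1 h2 h1' h2'
      have hc := f.symm.trans f'
      rw [Int.cast_inj] at hc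
      rw [Sym2.eq_iff]
      rcases h3 with h3 | h3 <;> rcases h3' with h3' | h3'
      · exact Or.inl ⟨hinj _ _ (by omega) (by omega), hinj _ _ (by omega) (by omega)⟩
      · exact Or.inr ⟨hinj _ _ (by omega) (by omega), hinj _ _ (by omega) (by omega)⟩
      · exact Or.inr ⟨hinj _ _ (by omega) (by omega), hinj _ _ (by omega) (by omega)⟩
      · exact Or.inl ⟨hinj _ _ (by omega) (by omega), hinj _ _ (by omega) (by omega)⟩

/-- The path on `n` vertices, drawn on a line and labelled `1, …, n` from one leaf to the other. -/
def path (n : ℕ) : PlaneGraph (Fin n) :=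
  latticePlaneGraph (SimpleGraph.pathGraph n) (fun p => p.val + 1)
    (by
      refine ⟨fun p _ => ?_, fun p _ q _ h => ?_, fun k hk => ?_⟩
      · have := p.isLt
        simp only [Fintype.card_fin, Set.mem_Icc]
        omega
      · exact Fin.ext (by simpa using h)
      · simp only [Fintype.card_fin, Set.mem_Icc] at hk
        exact ⟨⟨k - 1, by omega⟩, Set.mem_univ _, by simp only; omega⟩)
    (fun p => (p.val : ℤ)) (fun _ => 0)
    (by intro u v h _; exact Fin.ext (by exact_mod_cast h))
    (by intro u v h; rw [SimpleGraph.pathGraph_adj] at h; right; refine ⟨rfl, ?_⟩; omega)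

/-- The boustrophedon label of the vertex `(p, q)` of the `ℓ × m` grid, with `1 ≤ p ≤ ℓ` and
`1 ≤ q ≤ m`: it is `2sℓ + p` if `q = 2s + 1` and `2sℓ - p + 1` if `q = 2s`. -/
def boustrophedon (ℓ p q : ℕ) : ℕ :=
  if Odd q then 2 * (q / 2) * ℓ + p else 2 * (q / 2) * ℓ + 1 - p

/-- The boustrophedon label of the vertex `(p, q, r)` of the `ℓ × m × n` grid, with `1 ≤ p ≤ ℓ`,
`1 ≤ q ≤ m` and `1 ≤ r ≤ n`. Here `s = ⌊q/2⌋` and `t = ⌊r/2⌋`. -/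
def boustrophedon₃ (ℓ m p q r : ℤ) : ℤ :=
  if Odd r then
    if Odd q then 2 * (r / 2) * ℓ * m + 2 * (q / 2) * ℓ + p
    else 2 * (r / 2) * ℓ * m + 2 * (q / 2) * ℓ - p + 1
  else
    if Odd q then 2 * (r / 2) * ℓ * m - 2 * (q / 2) * ℓ - p + 1
    else 2 * (r / 2) * ℓ * m - 2 * (q / 2) * ℓ + p

theorem boustrophedon_bijOn (ℓ m : ℕ) :
    Set.BijOn (fun v : Fin ℓ × Fin m => boustrophedon ℓ (v.1.val + 1) (v.2.val + 1)) Set.univ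
      (Set.Icc 1 (Fintype.card (Fin ℓ × Fin m))) := by
  have key : ∀ v : Fin ℓ × Fin m, ∃ p' < ℓ,
      boustrophedon ℓ (v.1.val + 1) (v.2.val + 1) = ℓ * v.2.val + p' + 1 ∧
      p' = if Even v.2.val then v.1.val else ℓ - 1 - v.1.val := by
    rintro ⟨⟨p, hp⟩, ⟨q, hq⟩⟩
    simp only [boustrophedon]
    rcases Nat.even_or_odd' q with ⟨s, rfl | rfl⟩
    · refine ⟨p, hp, ?_, by simp⟩
      rw [if_pos (by exact ⟨s, rfl⟩), show (2 * s + 1) / 2 = s by omega]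
      ring
    · refine ⟨ℓ - 1 - p, by omega, ?_, by simp⟩
      have h2 : ¬ Odd (2 * s + 1 + 1) := by
        rw [Nat.not_odd_iff_even]
        exact ⟨s + 1, by ring⟩
      rw [if_neg h2, show (2 * s + 1 + 1) / 2 = s + 1 by omega,
        show 2 * (s + 1) * ℓ = ℓ * (2 * s + 1) + ℓ by ring]
      omega
  have hinj : Function.Injective
      (fun v : Fin ℓ × Fin m => boustrophedon ℓ (v.1.val + 1) (v.2.val + 1)) := by
    intro v w h
    obtain ⟨p, hp, h1, h2⟩ := key v
    obtain ⟨p', hp', h1', h2'⟩ := key w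
    simp only [h1, h1'] at h
    have hpp : ℓ * v.2.val + p = ℓ * w.2.val + p' := by omega
    have hl : 0 < ℓ := by omega
    have hmod := congrArg (· % ℓ) hpp
    have hdiv := congrArg (· / ℓ) hpp
    simp only [Nat.mul_add_mod, Nat.mod_eq_of_lt hp, Nat.mod_eq_of_lt hp'] at hmod
    simp only [Nat.mul_add_div hl, Nat.div_eq_of_lt hp, Nat.div_eq_of_lt hp', add_zero] at hdiv
    have hv := v.1.isLt
    have hw := w.1.isLt
    rw [h2, h2', hdiv] at hmod
    refine Prod.ext (Fin.ext ?_) (Fin.ext hdiv)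
    split_ifs at hmod <;> omega
  have hmaps : ∀ v : Fin ℓ × Fin m, boustrophedon ℓ (v.1.val + 1) (v.2.val + 1) ∈
      Finset.Icc 1 (Fintype.card (Fin ℓ × Fin m)) := by
    intro v
    obtain ⟨p, hp, h1, _⟩ := key v
    have h3 : ℓ * (v.2.val + 1) ≤ ℓ * m := Nat.mul_le_mul_left _ v.2.isLt
    rw [mul_add] at h3
    simp only [Fintype.card_prod, Fintype.card_fin, Finset.mem_Icc, h1]
    omega
  have himg : Finset.univ.image
      (fun v : Fin ℓ × Fin m => boustrophedon ℓ (v.1.val + 1) (v.2.val + 1)) =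
      Finset.Icc 1 (Fintype.card (Fin ℓ × Fin m)) := by
    apply Finset.eq_of_subset_of_card_le
    · intro k hk
      obtain ⟨v, _, rfl⟩ := Finset.mem_image.1 hk
      exact hmaps v
    · rw [Finset.card_image_of_injective _ hinj, Nat.card_Icc, Finset.card_univ]
      omega
  refine ⟨fun v _ => Finset.mem_Icc.1 (hmaps v), hinj.injOn, fun k hk => ?_⟩
  have hk' := Finset.mem_Icc.2 hk
  rw [← himg] at hk'
  obtain ⟨v, _, hv⟩ := Finset.mem_image.1 hk'
  exact ⟨v, Set.mem_univ _, hv⟩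

/-- The `ℓ × m` grid with its standard drawing in the plane and the boustrophedon labelling. -/
def grid (ℓ m : ℕ) : PlaneGraph (Fin ℓ × Fin m) :=
  latticePlaneGraph (SimpleGraph.pathGraph ℓ □ SimpleGraph.pathGraph m)
    (fun v => boustrophedon ℓ (v.1.val + 1) (v.2.val + 1)) (boustrophedon_bijOn ℓ m)
    (fun v => (v.1.val : ℤ)) (fun v => (v.2.val : ℤ))
    (by
      intro u v h h'
      exact Prod.ext (Fin.ext (by exact_mod_cast h)) (Fin.ext (by exact_mod_cast h')))
    (by
      intro u v h
      rw [SimpleGraph.boxProd_adj, SimpleGraph.pathGraph_adj, SimpleGraph.pathGraph_adj] at h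
      rcases h with ⟨h, h'⟩ | ⟨h, h'⟩
      · rw [h']; right; refine ⟨rfl, ?_⟩; omega
      · rw [h']; left; refine ⟨rfl, ?_⟩; omega)

end MonopoleDimer

end

namespace MonopoleDimer

/-! ## Closed lattice walks and crossing parities -/

/-! A labelled plane graph is Kasteleyn (`PlaneGraph.IsKasteleyn`) when the sign of each directed
cycle is the product over its arcs of +1 for an ascent and -1 for a descent of the labels. The sign
of a decomposition of a projected loop is then a product over the arcs of the projection, so the
chosen decomposition does not matter. Combined with the factor for reversed copies, the sign of a
loop becomes minus a product of ±1 over its arcs, each recording whether the arc follows the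
oriented product (`loopSign_eq`). The partition function thus depends only on the weighted graph and
its orientation (`partitionFunction_eq_of_iso`). The two orientations agree because the
three-dimensional boustrophedon label arises from the plane one by iteration in either order
(`boustrophedon₃_eq_fst`, `boustrophedon₃_eq_snd`).

It remains that paths and grids are Kasteleyn. Their cycles are even, so the claim is that descents
and enclosed points have different parities (`IsLatticeLoop.descent_eq`). Around a unit cell the
number of descents is odd. The leftmost vertex `c` of the top row of a loop is the top left corner
of a cell; let `w` be the opposite corner. If `w` is off the loop, replacing `c` by `w` changes both
parities; otherwise, dropping `c` cuts the loop at `w` into two smaller ones, over which the counts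
add up correctly. Induction ends at doubled edges. Here a point counts as enclosed when a ray going
up from the cell on its upper right crosses the loop an odd number of times.

That this agrees with lying in a bounded component is a Jordan curve theorem for lattice cycles
(`lattice_enclosed_iff`). The crossing parity is locally constant off the curve and vanishes far
away, so odd parity implies bounded. Conversely, the cells along the left of a cycle share one
component, as do those along the right, and every cell either sees infinity upwards or belongs to
one of these two. -/

/-- The sum of `g` over the steps of the walk from `x` through the vertices of `t` to `z`. -/
def walkSum {α M : Type*} [AddCommMonoid M] (g : α → α → M) : α → List α → α → M
  | x, [], z => g x z
  | x, y :: t, z => g x y + walkSum g y t z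

section walkSum

variable {α M : Type*} [AddCommMonoid M]

theorem walkSum_append_cons (g : α → α → M) (x : α) (s : List α) (y : α) (t : List α) (z : α) :
    walkSum g x (s ++ y :: t) z = walkSum g x s y + walkSum g y t z := by
  induction s generalizing x with
  | nil => rfl
  | cons a s ih => simp only [List.cons_append, walkSum, ih, add_assoc]

theorem walkSum_congr {r : α → α → Prop} {g g' : α → α → M} {x : α} {t : List α} {z : α}
    (hc : List.IsChain r (x :: (t ++ [z])))
    (h : ∀ u ∈ x :: (t ++ [z]), ∀ v ∈ x :: (t ++ [z]), r u v → g u v = g' u v) :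
    walkSum g x t z = walkSum g' x t z := by
  induction t generalizing x with
  | nil =>
    simp only [List.nil_append, List.isChain_cons_cons] at hc
    exact h x (by simp) z (by simp) hc.1
  | cons a s ih =>
    simp only [List.cons_append, List.isChain_cons_cons] at hc
    simp only [walkSum]
    rw [h x (by simp) a (by simp) hc.1, ih hc.2]
    intro u hu v hv
    exact h u (List.mem_cons_of_mem _ hu) v (List.mem_cons_of_mem _ hv)

theorem walkSum_add (g g' : α → α → M) (x : α) (t : List α) (z : α) :
    walkSum (fun u v => g u v + g' u v) x t z = walkSum g x t z + walkSum g' x t z := by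
  induction t generalizing x with
  | nil => rfl
  | cons a s ih => simp only [walkSum, ih]; abel

theorem walkSum_zero (x : α) (t : List α) (z : α) :
    walkSum (fun _ _ => (0 : M)) x t z = 0 := by
  induction t generalizing x with
  | nil => rfl
  | cons a s ih => simp [walkSum, ih]

theorem walkSum_eq_zero {g : α → α → M} {x : α} {t : List α}
    (h : ∀ u ∈ x :: t, ∀ v ∈ x :: t, g u v = 0) : walkSum g x t x = 0 := by
  rw [← walkSum_zero (M := M) x t x]
  apply walkSum_congr (r := fun _ _ => True)
  · exact (List.pairwise_of_forall fun _ _ => trivial).isChain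
  · intro u hu v hv _
    exact h u (by simp at hu ⊢; tauto) v (by simp at hv ⊢; tauto)

theorem walkSum_telescope (f : α → ZMod 2) (x : α) (t : List α) (z : α) :
    walkSum (fun u v => f u + f v) x t z = f x + f z := by
  induction t generalizing x with
  | nil => rfl
  | cons a s ih =>
    simp only [walkSum, ih]
    linear_combination CharTwo.add_self_eq_zero (f a)

end walkSum

/-- Two points of `ℤ²` at distance one. -/
def LatticeAdj (u v : ℤ × ℤ) : Prop :=
  (u.1 = v.1 ∧ (v.2 = u.2 + 1 ∨ u.2 = v.2 + 1)) ∨ (u.2 = v.2 ∧ (v.1 = u.1 + 1 ∨ u.1 = v.1 + 1))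

/-- Whether the step `u → v` is horizontal and crosses the vertical ray going up from the centre of
the unit cell with lower left corner `P`. -/
def crossing (P u v : ℤ × ℤ) : ZMod 2 :=
  if u.2 = v.2 ∧ P.2 < u.2 ∧ ((u.1 = P.1 ∧ v.1 = P.1 + 1) ∨ (v.1 = P.1 ∧ u.1 = P.1 + 1))
  then 1 else 0

/-- Whether the step `u → v` runs along the edge from `P` to the point to its right. -/
def onHorizontal (P u v : ℤ × ℤ) : ZMod 2 :=
  if u.2 = v.2 ∧ P.2 = u.2 ∧ ((u.1 = P.1 ∧ v.1 = P.1 + 1) ∨ (v.1 = P.1 ∧ u.1 = P.1 + 1))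
  then 1 else 0

/-- Whether the step `u → v` runs along the edge from `P` to the point above it. -/
def onVertical (P u v : ℤ × ℤ) : ZMod 2 :=
  if u.1 = v.1 ∧ P.1 = u.1 ∧ ((u.2 = P.2 ∧ v.2 = P.2 + 1) ∨ (v.2 = P.2 ∧ u.2 = P.2 + 1))
  then 1 else 0

/-- Whether the step `u → v` descends in the boustrophedon order of the lattice. -/
def descent (u v : ℤ × ℤ) : ZMod 2 :=
  if v.2 < u.2 ∨ (u.2 = v.2 ∧ ((u.2 % 2 = 0 ∧ v.1 < u.1) ∨ (u.2 % 2 = 1 ∧ u.1 < v.1)))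
  then 1 else 0

/-- The lower ray is the upper one extended across the common edge of the two cells. -/
theorem crossing_below (i j : ℤ) (u v : ℤ × ℤ) :
    crossing (i, j - 1) u v = crossing (i, j) u v + onHorizontal (i, j) u v := by
  unfold crossing onHorizontal
  split_ifs <;> first | rfl | (exfalso; simp only at *; omega)

/-- Each end of the step on the line between the two columns, above height `j`, counts once. A
horizontal step with such an end crosses exactly one of the two rays; a vertical step has none or
both ends there, except the edge starting at height `j`, which `onVertical` corrects. Over a closed
walk the end terms cancel. -/
theorem crossing_left {u v : ℤ × ℤ} (h : LatticeAdj u v) (i j : ℤ) :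
    crossing (i - 1, j) u v = crossing (i, j) u v + onVertical (i, j) u v +
      ((if u.1 = i ∧ j < u.2 then 1 else 0) + (if v.1 = i ∧ j < v.2 then 1 else 0)) := by
  unfold LatticeAdj at h
  unfold crossing onVertical
  split_ifs <;> first | rfl | (exfalso; simp only at *; omega)

theorem LatticeAdj.symm {u v : ℤ × ℤ} (h : LatticeAdj u v) : LatticeAdj v u := by
  unfold LatticeAdj at *
  omega

theorem descent_add_descent {u v : ℤ × ℤ} (h : LatticeAdj u v) :
    descent u v + descent v u = 1 := by
  unfold LatticeAdj at h
  unfold descent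
  split_ifs <;> first | rfl | (exfalso; omega)

theorem crossing_comm (P u v : ℤ × ℤ) : crossing P u v = crossing P v u := by
  unfold crossing
  congr 1
  ext
  constructor <;> rintro ⟨h1, h2, h3⟩ <;> refine ⟨h1.symm, h1 ▸ h2, h3.symm⟩

/-- The crossing parity of the closed walk `c, t, c` at the unit cell with lower left corner `P`. -/
def walkParity (c : ℤ × ℤ) (t : List (ℤ × ℤ)) (P : ℤ × ℤ) : ZMod 2 :=
  walkSum (crossing P) c t c

theorem walkParity_below {c : ℤ × ℤ} {t : List (ℤ × ℤ)} {i j : ℤ} (h : (i, j) ∉ c :: t) :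
    walkParity c t (i, j - 1) = walkParity c t (i, j) := by
  unfold walkParity
  rw [show crossing (i, j - 1) = fun u v => crossing (i, j) u v + onHorizontal (i, j) u v from
    funext fun u => funext fun v => crossing_below i j u v, walkSum_add,
    walkSum_eq_zero (g := onHorizontal (i, j)), add_zero]
  intro u hu v hv
  rw [onHorizontal, if_neg]
  rintro ⟨h1, h2, h3 | h3⟩
  · exact h (by convert hu using 1; ext <;> simp only <;> omega)
  · exact h (by convert hv using 1; ext <;> simp only <;> omega)

theorem walkParity_left {c : ℤ × ℤ} {t : List (ℤ × ℤ)} {i j : ℤ}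
    (hc : List.IsChain LatticeAdj (c :: (t ++ [c]))) (h : (i, j) ∉ c :: t) :
    walkParity c t (i - 1, j) = walkParity c t (i, j) := by
  unfold walkParity
  rw [walkSum_congr hc (fun u _ v _ h => crossing_left h i j), walkSum_add, walkSum_add,
    walkSum_eq_zero (g := onVertical (i, j)),
    walkSum_telescope (fun u : ℤ × ℤ => if u.1 = i ∧ j < u.2 then 1 else 0),
    CharTwo.add_self_eq_zero, add_zero, add_zero]
  intro u hu v hv
  rw [onVertical, if_neg]
  rintro ⟨h1, h2, h3 | h3⟩
  · exact h (by convert hu using 1; ext <;> simp only <;> omega)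
  · exact h (by convert hv using 1; ext <;> simp only <;> omega)

theorem walkParity_eq_of_adj {c : ℤ × ℤ} {t : List (ℤ × ℤ)}
    (hc : List.IsChain LatticeAdj (c :: (t ++ [c]))) {P Q : ℤ × ℤ} (hPQ : LatticeAdj P Q)
    (hP : P ∉ c :: t) (hQ : Q ∉ c :: t) : walkParity c t P = walkParity c t Q := by
  obtain ⟨i, j⟩ := P
  obtain ⟨k, l⟩ := Q
  simp only [LatticeAdj] at hPQ
  rcases hPQ with ⟨rfl, rfl | rfl⟩ | ⟨rfl, rfl | rfl⟩
  · rw [← walkParity_below hQ, add_sub_cancel_right]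
  · rw [← walkParity_below hP, add_sub_cancel_right]
  · rw [← walkParity_left hc hQ, add_sub_cancel_right]
  · rw [← walkParity_left hc hP, add_sub_cancel_right]

/-- A discrete substitute for connectedness: it shows that one part of a split loop stays outside
the other. -/
theorem walkParity_eq_zero_along {c : ℤ × ℤ} {t : List (ℤ × ℤ)}
    (hc : List.IsChain LatticeAdj (c :: (t ++ [c]))) {a : ℤ × ℤ} {s : List (ℤ × ℤ)}
    (hs : List.IsChain LatticeAdj (a :: s)) (hd : ∀ u ∈ a :: s, u ∉ c :: t)
    (ha : walkParity c t a = 0) : ∀ u ∈ a :: s, walkParity c t u = 0 := by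
  induction s generalizing a with
  | nil => simpa using ha
  | cons b s ih =>
    rw [List.isChain_cons_cons] at hs
    have hb : walkParity c t b = 0 := by
      rw [← walkParity_eq_of_adj hc hs.1 (hd a (by simp)) (hd b (by simp)), ha]
    intro u hu
    rcases List.mem_cons.1 hu with rfl | hu
    · exact ha
    · exact ih hs.2 (fun v hv => hd v (List.mem_cons_of_mem _ hv)) hb u hu

/-- The parity of the number of points of the box `X × Y` enclosed by a closed walk. -/
def enclosedParity (X Y : Finset ℤ) (c : ℤ × ℤ) (t : List (ℤ × ℤ)) : ZMod 2 :=
  ∑ P ∈ X ×ˢ Y with P ∉ c :: t, walkParity c t P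

/-- A closed lattice walk inside the box `X × Y` without repeated vertices, of length at least two. -/
structure IsLatticeLoop (X Y : Finset ℤ) (c : ℤ × ℤ) (t : List (ℤ × ℤ)) : Prop where
  nodup : (c :: t).Nodup
  ne_nil : t ≠ []
  chain : List.IsChain LatticeAdj (c :: (t ++ [c]))
  mem_box : ∀ u ∈ c :: t, u ∈ X ×ˢ Y

theorem IsLatticeLoop.rotate {X Y : Finset ℤ} {c c' : ℤ × ℤ} {s r : List (ℤ × ℤ)}
    (h : IsLatticeLoop X Y c (s ++ c' :: r)) : IsLatticeLoop X Y c' (r ++ c :: s) := by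
  have hp : (c' :: (r ++ c :: s)).Perm (c :: (s ++ c' :: r)) := by
    rw [← List.cons_append, ← List.cons_append]
    exact List.perm_append_comm
  refine ⟨hp.nodup_iff.2 h.nodup, by simp, ?_, fun u hu => h.mem_box u (hp.mem_iff.1 hu)⟩
  have := h.chain
  rw [List.append_assoc, List.cons_append, ← List.cons_append, List.isChain_split] at this
  rw [List.append_assoc, List.cons_append, ← List.cons_append, List.isChain_split]
  exact ⟨this.2, this.1⟩

theorem walkSum_rotate {α M : Type*} [AddCommMonoid M] (g : α → α → M) (c c' : α) (s r : List α) :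
    walkSum g c' (r ++ c :: s) c' = walkSum g c (s ++ c' :: r) c := by
  rw [walkSum_append_cons, walkSum_append_cons, add_comm]

theorem enclosedParity_rotate (X Y : Finset ℤ) (c c' : ℤ × ℤ) (s r : List (ℤ × ℤ)) :
    enclosedParity X Y c' (r ++ c :: s) = enclosedParity X Y c (s ++ c' :: r) := by
  unfold enclosedParity walkParity
  apply Finset.sum_congr
  · ext P
    simp only [Finset.mem_filter, List.mem_cons, List.mem_append]
    tauto
  · intro P _
    exact walkSum_rotate _ _ _ _ _

/-! ### Modifying a loop at its top left corner -/

section Corner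

variable {X Y : Finset ℤ} {a b c w : ℤ × ℤ}

/-- The points `a` and `b` are the right and the lower neighbour of `c`, in some order. -/
def IsCorner (c a b : ℤ × ℤ) : Prop :=
  (a = (c.1 + 1, c.2) ∧ b = (c.1, c.2 - 1)) ∨ (a = (c.1, c.2 - 1) ∧ b = (c.1 + 1, c.2))

/-- Around a unit cell the two vertical edges, both ascending upwards, have opposite senses, and the
two horizontal ones, in consecutive rows, have the same sense. So the boundary has an odd number of
descents, and reversing the two steps through the opposite corner preserves this. -/
theorem descent_corner (h : IsCorner c a b) :
    descent b c + descent c a =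
      descent (c.1 + 1, c.2 - 1) a + descent b (c.1 + 1, c.2 - 1) + 1 := by
  obtain ⟨i, j⟩ := c
  rcases h with ⟨rfl, rfl⟩ | ⟨rfl, rfl⟩ <;> simp only [descent] <;> split_ifs <;>
    first | decide | (exfalso; simp only [true_and] at *; omega)

/-- The two paths from `b` to `a` together bound one cell, so a ray distinguishes them exactly when
it starts in that cell. -/
theorem crossing_corner (h : IsCorner c a b) (P : ℤ × ℤ) :
    crossing P b c + crossing P c a =
      crossing P (c.1 + 1, c.2 - 1) a + crossing P b (c.1 + 1, c.2 - 1) +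
        if P = (c.1, c.2 - 1) then 1 else 0 := by
  obtain ⟨i, j⟩ := c
  obtain ⟨k, l⟩ := P
  rcases h with ⟨rfl, rfl⟩ | ⟨rfl, rfl⟩ <;> simp only [crossing, Prod.mk.injEq] <;> split_ifs <;>
    first | decide | (exfalso; simp only [true_and] at *; omega)

/-- No step lies above height `c.2`. From the cell whose top left corner is `c`, the ray could only
meet the top edge of that cell, which ends in `c`. -/
theorem walkParity_eq_zero_of_top {x : ℤ × ℤ} {t : List (ℤ × ℤ)}
    (h : ∀ u ∈ x :: t, u.2 ≤ c.2 ∧ u ≠ c) {P : ℤ × ℤ}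
    (hP : c.2 ≤ P.2 ∨ P = (c.1, c.2 - 1)) : walkParity x t P = 0 := by
  apply walkSum_eq_zero
  intro u hu v hv
  rw [crossing, if_neg]
  rintro ⟨h1, h2, h3⟩
  obtain ⟨hu1, hu2⟩ := h u hu
  obtain ⟨hv1, hv2⟩ := h v hv
  rcases hP with hP | rfl
  · omega
  · simp only at h2 h3
    rcases h3 with h3 | h3
    · exact hu2 (Prod.ext (by omega) (by omega))
    · exact hv2 (Prod.ext (by omega) (by omega))

theorem IsCorner.symm (h : IsCorner c a b) : IsCorner c b a := by
  unfold IsCorner at *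
  tauto

theorem IsCorner.top (h : IsCorner c a b) : c.2 ≤ a.2 ∨ a = (c.1, c.2 - 1) := by
  rcases h with ⟨rfl, rfl⟩ | ⟨rfl, rfl⟩
  · exact Or.inl le_rfl
  · exact Or.inr rfl

theorem IsCorner.adj_left (h : IsCorner c a b) : LatticeAdj (c.1 + 1, c.2 - 1) a := by
  rcases h with ⟨rfl, rfl⟩ | ⟨rfl, rfl⟩ <;> simp [LatticeAdj]

theorem IsCorner.mem_box (h : IsCorner c a b) (ha : a ∈ X ×ˢ Y) (hb : b ∈ X ×ˢ Y) :
    (c.1 + 1, c.2 - 1) ∈ X ×ˢ Y := by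
  rw [Finset.mem_product] at *
  rcases h with ⟨rfl, rfl⟩ | ⟨rfl, rfl⟩
  · exact ⟨ha.1, hb.2⟩
  · exact ⟨hb.1, ha.2⟩

theorem walkSum_cons_concat {α M : Type*} [AddCommMonoid M] (g : α → α → M) (x y : α) (s : List α)
    (z z' : α) : walkSum g x (y :: (s ++ [z])) z' = g x y + walkSum g y s z + g z z' := by
  rw [walkSum, walkSum_append_cons, walkSum, add_assoc]

/-- If the lattice point `w` opposite to the top corner `c` is not on the loop, `c` can be replaced
by `w`. -/
theorem IsLatticeLoop.replace_corner {s : List (ℤ × ℤ)}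
    (h : IsLatticeLoop X Y c (a :: (s ++ [b]))) (hc : IsCorner c a b)
    (hw : w = (c.1 + 1, c.2 - 1)) (hws : w ∉ c :: a :: (s ++ [b])) :
    IsLatticeLoop X Y w (a :: (s ++ [b])) := by
  refine ⟨?_, by simp, ?_, ?_⟩
  · have := h.nodup
    rw [List.nodup_cons] at this ⊢
    exact ⟨fun h' => hws (List.mem_cons_of_mem _ h'), this.2⟩
  · have := h.chain
    rw [List.cons_append, List.isChain_cons_cons, List.append_assoc, List.singleton_append,
      ← List.cons_append, List.isChain_split] at this ⊢
    refine ⟨hw ▸ hc.adj_left, this.2.1, ?_⟩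
    rw [List.isChain_cons_cons]
    exact ⟨hw ▸ hc.symm.adj_left.symm, List.isChain_singleton _⟩
  · intro u hu
    rcases List.mem_cons.1 hu with rfl | hu
    · rw [hw]
      exact hc.mem_box (h.mem_box a (by simp)) (h.mem_box b (by simp))
    · exact h.mem_box u (List.mem_cons_of_mem _ hu)

theorem walkParity_replace_corner {s : List (ℤ × ℤ)} (hc : IsCorner c a b)
    (hw : w = (c.1 + 1, c.2 - 1)) (P : ℤ × ℤ) :
    walkParity c (a :: (s ++ [b])) P =
      walkParity w (a :: (s ++ [b])) P + if P = (c.1, c.2 - 1) then 1 else 0 := by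
  unfold walkParity
  rw [walkSum_cons_concat, walkSum_cons_concat]
  have := crossing_corner hc P
  rw [← hw] at this
  linear_combination this

theorem enclosedParity_replace_corner {s : List (ℤ × ℤ)}
    (h : IsLatticeLoop X Y c (a :: (s ++ [b]))) (hc : IsCorner c a b)
    (htop : ∀ u ∈ c :: a :: (s ++ [b]), u.2 ≤ c.2)
    (hw : w = (c.1 + 1, c.2 - 1)) (hws : w ∉ c :: a :: (s ++ [b])) :
    enclosedParity X Y c (a :: (s ++ [b])) = enclosedParity X Y w (a :: (s ++ [b])) + 1 := by
  have hbox : w ∈ X ×ˢ Y := by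
    rw [hw]
    exact hc.mem_box (h.mem_box a (by simp)) (h.mem_box b (by simp))
  have hcw : c ≠ w := fun h' => hws (by simp [h'])
  have hct : c ∉ a :: (s ++ [b]) := (List.nodup_cons.1 h.nodup).1
  have hwt : w ∉ a :: (s ++ [b]) := fun h' => hws (List.mem_cons_of_mem _ h')
  have htop' : ∀ u ∈ w :: a :: (s ++ [b]), u.2 ≤ c.2 ∧ u ≠ c := by
    intro u hu
    rcases List.mem_cons.1 hu with rfl | hu
    · exact ⟨by simp [hw], hcw.symm⟩
    · exact ⟨htop u (List.mem_cons_of_mem _ hu), fun h' => hct (h' ▸ hu)⟩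
  have hdown : (c.1, c.2 - 1) ∈ a :: (s ++ [b]) := by
    rcases hc with ⟨rfl, rfl⟩ | ⟨rfl, rfl⟩ <;> simp
  have h1 : walkParity w (a :: (s ++ [b])) c = 0 :=
    walkParity_eq_zero_of_top htop' (Or.inl le_rfl)
  -- The old loop encloses `w`: being off the loop, `w` has the parity of the cell to its left,
  -- which is the cell below the corner.
  have h2 : walkParity c (a :: (s ++ [b])) w = 1 := by
    have := walkParity_left h.chain (i := c.1 + 1) (j := c.2 - 1) (by rwa [← hw])
    rw [add_sub_cancel_right, walkParity_replace_corner hc hw, if_pos rfl,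
      walkParity_eq_zero_of_top htop' (Or.inr rfl), zero_add] at this
    rw [hw, ← this]
  -- The points off the old loop are `w` and those off both loops; the points off the new loop are
  -- `c` and those off both.
  have e1 : (X ×ˢ Y).filter (fun P => P ∉ c :: a :: (s ++ [b])) =
      insert w ((X ×ˢ Y).filter fun P => P ≠ c ∧ P ≠ w ∧ P ∉ a :: (s ++ [b])) := by
    ext P
    simp only [Finset.mem_filter, Finset.mem_insert, List.mem_cons (b := c), not_or]
    by_cases hP : P = w
    · subst hP
      simp [hbox, hcw.symm]
      simpa using hwt
    · simp [hP]
  have e2 : (X ×ˢ Y).filter (fun P => P ∉ w :: a :: (s ++ [b])) =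
      insert c ((X ×ˢ Y).filter fun P => P ≠ c ∧ P ≠ w ∧ P ∉ a :: (s ++ [b])) := by
    ext P
    simp only [Finset.mem_filter, Finset.mem_insert, List.mem_cons (b := w), not_or]
    by_cases hP : P = c
    · subst hP
      simp [h.mem_box P (by simp), hcw]
      simpa using hct
    · simp [hP]
  unfold enclosedParity
  rw [e1, e2, Finset.sum_insert (by simp), Finset.sum_insert (by simp), h1, h2, zero_add, add_comm]
  congr 1
  apply Finset.sum_congr rfl
  intro P hP
  rw [walkParity_replace_corner hc hw, if_neg, add_zero]
  -- The one cell at which the parities differ is indexed by a neighbour of `c`, which lies on both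
  -- loops and is not counted.
  rintro rfl
  exact (Finset.mem_filter.1 hP).2.2.2 hdown

theorem walkSum_descent_replace_corner {s : List (ℤ × ℤ)} (hc : IsCorner c a b)
    (hw : w = (c.1 + 1, c.2 - 1)) :
    walkSum descent c (a :: (s ++ [b])) c = walkSum descent w (a :: (s ++ [b])) w + 1 := by
  rw [walkSum_cons_concat, walkSum_cons_concat]
  have := descent_corner hc
  rw [← hw] at this
  linear_combination this

/-- If the lattice point `w` opposite to the top corner `c` is on the loop, the loop without `c`
splits into two loops that meet in `w`. -/
theorem IsLatticeLoop.split_left {s r : List (ℤ × ℤ)}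
    (h : IsLatticeLoop X Y c (a :: (s ++ w :: (r ++ [b])))) (hc : IsCorner c a b)
    (hw : w = (c.1 + 1, c.2 - 1)) : IsLatticeLoop X Y a (s ++ [w]) := by
  have hsub : (a :: (s ++ [w])).Sublist (c :: a :: (s ++ w :: (r ++ [b]))) := by
    apply List.Sublist.cons
    apply List.Sublist.cons_cons
    exact (List.Sublist.refl s).append (by simp)
  refine ⟨hsub.nodup h.nodup, by simp, ?_, fun u hu => h.mem_box u (hsub.mem hu)⟩
  have := h.chain
  rw [List.cons_append, List.isChain_cons_cons, List.append_assoc, List.cons_append,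
    ← List.cons_append, List.isChain_split] at this
  rw [List.append_assoc, List.singleton_append, ← List.cons_append, List.isChain_split,
    List.isChain_cons_cons]
  exact ⟨this.2.1, hw ▸ hc.adj_left, List.isChain_singleton _⟩

theorem IsLatticeLoop.split_right {s r : List (ℤ × ℤ)}
    (h : IsLatticeLoop X Y c (a :: (s ++ w :: (r ++ [b])))) (hc : IsCorner c a b)
    (hw : w = (c.1 + 1, c.2 - 1)) : IsLatticeLoop X Y w (r ++ [b]) := by
  have hsub : (w :: (r ++ [b])).Sublist (c :: a :: (s ++ w :: (r ++ [b]))) := by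
    apply List.Sublist.cons
    apply List.Sublist.cons
    exact List.sublist_append_right _ _
  refine ⟨hsub.nodup h.nodup, by simp, ?_, fun u hu => h.mem_box u (hsub.mem hu)⟩
  have := h.chain
  rw [List.cons_append, List.isChain_cons_cons, List.append_assoc, List.cons_append,
    ← List.cons_append, List.isChain_split, List.append_assoc, List.singleton_append,
    ← List.cons_append] at this
  rw [List.append_assoc, List.singleton_append, ← List.cons_append, List.isChain_split,
    List.isChain_cons_cons]
  exact ⟨(List.isChain_split.1 this.2.2).1, hw ▸ hc.symm.adj_left.symm, List.isChain_singleton _⟩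

/-- The steps `w → a` and `b → w` close up the two parts; the steps `b → c` and `c → a` occur only
in the whole loop. -/
theorem walkSum_split {M : Type*} [AddCommMonoid M] (g : ℤ × ℤ → ℤ × ℤ → M)
    {s r : List (ℤ × ℤ)} :
    walkSum g c (a :: (s ++ w :: (r ++ [b]))) c + (g w a + g b w) =
      walkSum g a (s ++ [w]) a + walkSum g w (r ++ [b]) w + (g b c + g c a) := by
  rw [walkSum, walkSum_append_cons, walkSum_append_cons, walkSum_append_cons, walkSum_append_cons,
    walkSum, walkSum, walkSum]
  abel

theorem walkParity_split {s r : List (ℤ × ℤ)} (hc : IsCorner c a b)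
    (hw : w = (c.1 + 1, c.2 - 1)) (P : ℤ × ℤ) :
    walkParity c (a :: (s ++ w :: (r ++ [b]))) P =
      walkParity a (s ++ [w]) P + walkParity w (r ++ [b]) P +
        if P = (c.1, c.2 - 1) then 1 else 0 := by
  unfold walkParity
  have h := walkSum_split (crossing P) (a := a) (b := b) (c := c) (w := w) (s := s) (r := r)
  have := crossing_corner hc P
  rw [← hw] at this
  linear_combination h + this

theorem walkSum_descent_split {s r : List (ℤ × ℤ)} (hc : IsCorner c a b)
    (hw : w = (c.1 + 1, c.2 - 1)) :
    walkSum descent c (a :: (s ++ w :: (r ++ [b]))) c =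
      walkSum descent a (s ++ [w]) a + walkSum descent w (r ++ [b]) w + 1 := by
  have h := walkSum_split descent (a := a) (b := b) (c := c) (w := w) (s := s) (r := r)
  have := descent_corner hc
  rw [← hw] at this
  linear_combination h + this

/-- Apart from `w`, each part lies outside the other, and `c` lies outside both. At points off the
whole loop the parities add, since the one exceptional cell is again indexed by a point on the loop.
-/
theorem enclosedParity_split {s r : List (ℤ × ℤ)}
    (h : IsLatticeLoop X Y c (a :: (s ++ w :: (r ++ [b])))) (hc : IsCorner c a b)
    (htop : ∀ u ∈ c :: a :: (s ++ w :: (r ++ [b])), u.2 ≤ c.2)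
    (hw : w = (c.1 + 1, c.2 - 1)) :
    enclosedParity X Y c (a :: (s ++ w :: (r ++ [b]))) =
      enclosedParity X Y a (s ++ [w]) + enclosedParity X Y w (r ++ [b]) := by
  have hl1 := h.split_left hc hw
  have hl2 := h.split_right hc hw
  have hct : c ∉ a :: (s ++ w :: (r ++ [b])) := (List.nodup_cons.1 h.nodup).1
  have hdown : (c.1, c.2 - 1) ∈ a :: (s ++ w :: (r ++ [b])) := by
    rcases hc with ⟨rfl, rfl⟩ | ⟨rfl, rfl⟩ <;> simp
  have htop1 : ∀ u ∈ a :: (s ++ [w]), u.2 ≤ c.2 ∧ u ≠ c := by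
    intro u hu
    have hu' : u ∈ a :: (s ++ w :: (r ++ [b])) := by simp at hu ⊢; tauto
    exact ⟨htop u (List.mem_cons_of_mem _ hu'), fun h' => hct (h' ▸ hu')⟩
  have htop2 : ∀ u ∈ w :: (r ++ [b]), u.2 ≤ c.2 ∧ u ≠ c := by
    intro u hu
    have hu' : u ∈ a :: (s ++ w :: (r ++ [b])) := by simp at hu ⊢; tauto
    exact ⟨htop u (List.mem_cons_of_mem _ hu'), fun h' => hct (h' ▸ hu')⟩
  have hdisj : (a :: s).Disjoint (w :: (r ++ [b])) := by
    have := (List.nodup_cons.1 h.nodup).2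
    rw [← List.cons_append] at this
    exact List.disjoint_of_nodup_append this
  have hw1 : w ∉ r ++ [b] := (List.nodup_cons.1 hl2.nodup).1
  -- The vertex `a` is outside the second loop because `c` was at the top; following `s` from there
  -- never meets that loop.
  have hout2 : ∀ u ∈ a :: s, walkParity w (r ++ [b]) u = 0 := by
    apply walkParity_eq_zero_along hl2.chain
    · have := hl1.chain
      rw [List.append_assoc, ← List.cons_append] at this
      exact this.left_of_append
    · exact hdisj
    · exact walkParity_eq_zero_of_top htop2 hc.top
  -- The same argument runs backwards from `b`, hence the reversed list.
  have hout1 : ∀ u ∈ r ++ [b], walkParity a (s ++ [w]) u = 0 := by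
    have hrev : b :: r.reverse = (r ++ [b]).reverse := by simp
    have := walkParity_eq_zero_along hl1.chain (a := b) (s := r.reverse) ?_ ?_ ?_
    · intro u hu
      apply this
      rw [hrev, List.mem_reverse]
      exact hu
    · rw [hrev, List.isChain_reverse]
      have := hl2.chain
      have := (List.isChain_cons.1 this).2
      refine this.left_of_append.imp ?_
      intro u v huv
      exact huv.symm
    · intro u hu hu'
      have hu2 : u ∈ r ++ [b] := by
        rw [hrev, List.mem_reverse] at hu
        exact hu
      have hu3 : u ∈ a :: s ∨ u = w := by simp at hu' ⊢; tauto
      rcases hu3 with hu3 | rfl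
      · exact hdisj hu3 (List.mem_cons_of_mem _ hu2)
      · exact hw1 hu2
    · exact walkParity_eq_zero_of_top htop1 hc.symm.top
  unfold enclosedParity
  have key : ∀ P ∈ X ×ˢ Y,
      (if P ∉ c :: a :: (s ++ w :: (r ++ [b])) then
        walkParity c (a :: (s ++ w :: (r ++ [b]))) P else 0) =
      (if P ∉ a :: (s ++ [w]) then walkParity a (s ++ [w]) P else 0) +
      (if P ∉ w :: (r ++ [b]) then walkParity w (r ++ [b]) P else 0) := by
    intro P _
    by_cases hPc : P = c
    · subst hPc
      rw [if_neg (by simp), walkParity_eq_zero_of_top htop1 (Or.inl le_rfl),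
        walkParity_eq_zero_of_top htop2 (Or.inl le_rfl)]
      simp
    by_cases hP1 : P ∈ a :: s
    · rw [if_neg (by simp at hP1 ⊢; tauto), if_neg (by simp at hP1 ⊢; tauto), hout2 P hP1]
      simp
    by_cases hP2 : P ∈ r ++ [b]
    · rw [if_neg (by simp at hP2 ⊢; tauto), hout1 P hP2,
        if_neg (c := P ∉ w :: (r ++ [b])) (by simp at hP2 ⊢; tauto)]
      simp
    by_cases hP3 : P = w
    · rw [if_neg (by simp [hP3]), if_neg (by simp [hP3]), if_neg (by simp [hP3]), add_zero]
    have hP : P ∉ a :: (s ++ w :: (r ++ [b])) := by simp at *; tauto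
    rw [if_pos (by simp at *; tauto), if_pos (by simp at *; tauto), if_pos (by simp at *; tauto),
      walkParity_split hc hw, if_neg, add_zero]
    rintro rfl
    exact hP hdown
  rw [Finset.sum_filter, Finset.sum_filter, Finset.sum_filter, ← Finset.sum_add_distrib]
  exact Finset.sum_congr rfl key

end Corner

/-! ### Descents and enclosed points of a loop, by induction -/

theorem IsLatticeLoop.exists_top {X Y : Finset ℤ} {c : ℤ × ℤ} {t : List (ℤ × ℤ)}
    (h : IsLatticeLoop X Y c t) : ∃ c' t', IsLatticeLoop X Y c' t' ∧
      (c' :: t').Perm (c :: t) ∧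
      (∀ u ∈ c' :: t', u.2 < c'.2 ∨ (u.2 = c'.2 ∧ c'.1 ≤ u.1)) ∧
      enclosedParity X Y c t = enclosedParity X Y c' t' ∧
      walkSum descent c t c = walkSum descent c' t' c' := by
  -- The lexicographic maximum of height and negated abscissa is the leftmost vertex of the top row.
  obtain ⟨c', hc', hmax⟩ := Finset.exists_max_image (c :: t).toFinset
    (fun u => toLex (u.2, -u.1)) ⟨c, by simp⟩
  have hmax' : ∀ u ∈ c :: t, u.2 < c'.2 ∨ (u.2 = c'.2 ∧ c'.1 ≤ u.1) := by
    intro u hu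
    have := hmax u (by simpa using hu)
    rw [Prod.Lex.le_iff] at this
    simp only [ofLex_toLex] at this
    omega
  rw [List.mem_toFinset] at hc'
  rcases List.mem_cons.1 hc' with rfl | hc'
  · exact ⟨c', t, h, List.Perm.refl _, hmax', rfl, rfl⟩
  · obtain ⟨s, r, rfl⟩ := List.append_of_mem hc'
    have hp : (c' :: (r ++ c :: s)).Perm (c :: (s ++ c' :: r)) := by
      rw [← List.cons_append, ← List.cons_append]
      exact List.perm_append_comm
    exact ⟨c', r ++ c :: s, h.rotate, hp, fun u hu => hmax' u (hp.mem_iff.1 hu),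
      (enclosedParity_rotate _ _ _ _ _ _).symm, (walkSum_rotate _ _ _ _ _).symm⟩

/-- Along a simple closed lattice walk, the number of descents in the boustrophedon order and the
number of enclosed lattice points have different parities. -/
theorem IsLatticeLoop.descent_eq {X Y : Finset ℤ} (hY : ∀ y ∈ Y, 0 ≤ y) {c : ℤ × ℤ}
    {t : List (ℤ × ℤ)} (h : IsLatticeLoop X Y c t) :
    walkSum descent c t c = enclosedParity X Y c t + 1 := by
  -- Every vertex weighs its height plus one. Lowering a corner decreases the total, and so does
  -- omitting vertices, since each has positive weight.
  induction hn : ((c :: t).map fun u => u.2.toNat + 1).sum using Nat.strong_induction_on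
    generalizing c t with
  | _ n ih =>
    subst hn
    obtain ⟨c', t', h', hp, hmax, e1, e2⟩ := h.exists_top
    rw [← (hp.map _).sum_eq] at ih
    rw [e1, e2]
    clear e1 e2 hp h c t
    obtain ⟨a, t, rfl⟩ := List.exists_cons_of_ne_nil h'.ne_nil
    rcases List.eq_nil_or_concat' t with rfl | ⟨s, b, rfl⟩
    -- A doubled edge encloses nothing and has exactly one descent.
    · have hch := h'.chain
      simp only [List.isChain_cons_cons, List.cons_append,
        List.nil_append] at hch
      have hz : ∀ P, walkParity c' [a] P = 0 := by
        intro P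
        simp only [walkParity, walkSum]
        rw [crossing_comm P a c', CharTwo.add_self_eq_zero]
      simp only [enclosedParity, hz, Finset.sum_const_zero, zero_add, walkSum]
      exact descent_add_descent hch.1
    -- The two neighbours are distinct, and by the choice of `c'` neither is above it or to its
    -- left.
    · have hcor : IsCorner c' a b := by
        have hch := h'.chain
        rw [List.cons_append, List.isChain_cons_cons, List.append_assoc, List.singleton_append,
          ← List.cons_append, List.isChain_split, List.isChain_cons_cons] at hch
        have h1 := hch.1
        have h2 := hch.2.2.1
        have ha := hmax a (by simp)
        have hb := hmax b (by simp)
        have hab : a ≠ b := by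
          have := h'.nodup
          rintro rfl
          simp at this
        have hab' : ¬ (a.1 = b.1 ∧ a.2 = b.2) := fun h => hab (Prod.ext h.1 h.2)
        simp only [IsCorner, Prod.ext_iff, LatticeAdj] at *
        omega
      have htop : ∀ u ∈ c' :: a :: (s ++ [b]), u.2 ≤ c'.2 := by
        intro u hu
        have := hmax u hu
        omega
      obtain ⟨w, hw⟩ : ∃ w : ℤ × ℤ, w = (c'.1 + 1, c'.2 - 1) := ⟨_, rfl⟩
      by_cases hws : w ∈ c' :: a :: (s ++ [b])
      · have hws' : w ∈ s := by
          have h1 : w ≠ c' := by rw [hw, Ne, Prod.ext_iff]; simp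
          have h2 : w ≠ a := by
            rcases hcor with ⟨h, _⟩ | ⟨h, _⟩ <;> rw [hw, h, Ne, Prod.ext_iff] <;> simp
          have h3 : w ≠ b := by
            rcases hcor with ⟨_, h⟩ | ⟨_, h⟩ <;> rw [hw, h, Ne, Prod.ext_iff] <;> simp
          simp at hws
          tauto
        obtain ⟨s, r, rfl⟩ := List.append_of_mem hws'
        rw [List.append_assoc, List.cons_append] at h' htop ih ⊢
        have i1 := ih _ ?_ (h'.split_left hcor hw) rfl
        have i2 := ih _ ?_ (h'.split_right hcor hw) rfl
        · rw [walkSum_descent_split hcor hw, enclosedParity_split h' hcor htop hw, i1, i2]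
          linear_combination CharTwo.add_self_eq_zero (1 : ZMod 2)
        · simp
          omega
        · simp
          omega
      · have hl := h'.replace_corner hcor hw hws
        rw [walkSum_descent_replace_corner hcor hw,
          enclosedParity_replace_corner h' hcor htop hw hws, ih _ ?_ hl rfl]
        -- Nonnegative height keeps `toNat` from truncating, so the weight really drops.
        have h0 : 0 ≤ w.2 := hY _ (Finset.mem_product.1 (hl.mem_box w (by simp))).2
        have : w.2 = c'.2 - 1 := by rw [hw]
        simp
        omega

/-! ## Enclosed lattice points -/

/-- A lattice point as a point of the plane. -/
def toPlane (P : ℤ × ℤ) : ℝ × ℝ := ((P.1 : ℝ), (P.2 : ℝ))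

/-- The centre of the unit cell with lower left corner `P`. -/
noncomputable def cellCentre (P : ℤ × ℤ) : ℝ × ℝ := ((P.1 : ℝ) + 1 / 2, (P.2 : ℝ) + 1 / 2)

/-- The lower left corner of the unit cell to the left of the step `u → v`. -/
def leftCell (u v : ℤ × ℤ) : ℤ × ℤ :=
  -- Midpoint of the step plus half its left normal is the cell centre, and subtracting one half
  -- from both coordinates gives the corner. For lattice steps the divisions are exact.
  ((u.1 + v.1 - (v.2 - u.2) - 1) / 2, (u.2 + v.2 + (v.1 - u.1) - 1) / 2)

/-- Of the four edges separating the four cells around `v`, only those towards `u` and `w` are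
barriers. The cells left of the incoming and the outgoing step lie on the same side of the barriers,
and the upper right cell lies on one of the sides. -/
theorem leftCell_eq_of_turn {α : Type*} (f : ℤ × ℤ → α) {u v w : ℤ × ℤ} (hu : LatticeAdj u v)
    (hw : LatticeAdj v w)
    (hN : u ≠ (v.1, v.2 + 1) → w ≠ (v.1, v.2 + 1) → f (v.1 - 1, v.2) = f v)
    (hW : u ≠ (v.1 - 1, v.2) → w ≠ (v.1 - 1, v.2) → f (v.1 - 1, v.2 - 1) = f (v.1 - 1, v.2))
    (hS : u ≠ (v.1, v.2 - 1) → w ≠ (v.1, v.2 - 1) → f (v.1 - 1, v.2 - 1) = f (v.1, v.2 - 1))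
    (hE : u ≠ (v.1 + 1, v.2) → w ≠ (v.1 + 1, v.2) → f (v.1, v.2 - 1) = f v) :
    f (leftCell u v) = f (leftCell v w) ∧
      (f v = f (leftCell v w) ∨ f v = f (leftCell w v)) := by
  obtain ⟨a, b⟩ := u
  obtain ⟨i, j⟩ := v
  obtain ⟨k, l⟩ := w
  have cN : leftCell (i, j + 1) (i, j) = (i, j) := by
    simp only [leftCell, Prod.mk.injEq]; omega
  have cN' : leftCell (i, j) (i, j + 1) = (i - 1, j) := by
    simp only [leftCell, Prod.mk.injEq]; omega
  have cW : leftCell (i - 1, j) (i, j) = (i - 1, j) := by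
    simp only [leftCell, Prod.mk.injEq]; omega
  have cW' : leftCell (i, j) (i - 1, j) = (i - 1, j - 1) := by
    simp only [leftCell, Prod.mk.injEq]; omega
  have cS : leftCell (i, j - 1) (i, j) = (i - 1, j - 1) := by
    simp only [leftCell, Prod.mk.injEq]; omega
  have cS' : leftCell (i, j) (i, j - 1) = (i, j - 1) := by
    simp only [leftCell, Prod.mk.injEq]; omega
  have cE : leftCell (i + 1, j) (i, j) = (i, j - 1) := by
    simp only [leftCell, Prod.mk.injEq]; omega
  have cE' : leftCell (i, j) (i + 1, j) = (i, j) := by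
    simp only [leftCell, Prod.mk.injEq]; omega
  have key : ∀ a b, LatticeAdj (a, b) (i, j) →
      (a, b) = (i, j + 1) ∨ (a, b) = (i - 1, j) ∨ (a, b) = (i, j - 1) ∨ (a, b) = (i + 1, j) := by
    intro a b h
    simp only [LatticeAdj, Prod.mk.injEq] at *
    omega
  have hne : ∀ p q : ℤ × ℤ, p ≠ q ↔ ¬ (p.1 = q.1 ∧ p.2 = q.2) := by
    intro p q; rw [Ne, Prod.ext_iff]
  have n1 : ((i, j + 1) : ℤ × ℤ) ≠ (i - 1, j) := by rw [hne]; simp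
  have n2 : ((i, j + 1) : ℤ × ℤ) ≠ (i, j - 1) := by rw [hne]; simp only; omega
  have n3 : ((i, j + 1) : ℤ × ℤ) ≠ (i + 1, j) := by rw [hne]; simp
  have n4 : ((i - 1, j) : ℤ × ℤ) ≠ (i, j - 1) := by rw [hne]; simp
  have n5 : ((i - 1, j) : ℤ × ℤ) ≠ (i + 1, j) := by rw [hne]; simp only; omega
  have n6 : ((i, j - 1) : ℤ × ℤ) ≠ (i + 1, j) := by rw [hne]; simp
  simp only at hN hW hS hE
  rcases key a b hu with h | h | h | h <;> rcases key k l hw.symm with h' | h' | h' | h' <;>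
    rw [h] at hN hW hS hE ⊢ <;> rw [h'] at hN hW hS hE ⊢ <;>
    simp only [cN, cN', cW, cW', cS, cS', cE, cE'] <;> grind

/-! ### Components of the complement of a lattice cycle -/

section Curve

variable {V : Type*} [Fintype V] [DecidableEq V] (pt : V → ℤ × ℤ) (d : Equiv.Perm V)

/-- The closed curve drawn by the directed cycle `d` on the lattice. -/
def latticeCurve : Set (ℝ × ℝ) :=
  ⋃ v ∈ d.support, segment ℝ (toPlane (pt v)) (toPlane (pt (d v)))

/-- The cycle `d` uses the edge from `P` to the point to its right. -/
def HorizontalStep (P : ℤ × ℤ) : Prop :=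
  ∃ v ∈ d.support, (pt v = P ∧ pt (d v) = (P.1 + 1, P.2)) ∨ (pt (d v) = P ∧ pt v = (P.1 + 1, P.2))

/-- The cycle `d` uses the edge from `P` to the point above it. -/
def VerticalStep (P : ℤ × ℤ) : Prop :=
  ∃ v ∈ d.support, (pt v = P ∧ pt (d v) = (P.1, P.2 + 1)) ∨ (pt (d v) = P ∧ pt v = (P.1, P.2 + 1))

/-- The crossing parity of the cycle `d` at the unit cell with lower left corner `P`. -/
def cycleParity (P : ℤ × ℤ) : ZMod 2 :=
  ∑ v ∈ d.support, crossing P (pt v) (pt (d v))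

/-- The connected component of the complement of the curve containing the centre of a cell. -/
def cellComponent (P : ℤ × ℤ) : Set (ℝ × ℝ) :=
  connectedComponentIn (latticeCurve pt d)ᶜ (cellCentre P)

variable {pt d}

theorem mem_segment_horizontal (P : ℤ × ℤ) (z : ℝ × ℝ) :
    z ∈ segment ℝ (toPlane P) (toPlane (P.1 + 1, P.2)) ↔
      z.2 = P.2 ∧ (P.1 : ℝ) ≤ z.1 ∧ z.1 ≤ P.1 + 1 := by
  constructor
  · rintro ⟨s, t, hs, ht, hst, rfl⟩
    have hs' : s = 1 - t := by linarith
    subst hs'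
    simp only [toPlane, Prod.smul_mk, Prod.mk_add_mk, smul_eq_mul]
    push_cast
    refine ⟨?_, ?_, ?_⟩ <;> linarith
  · rintro ⟨h1, h2, h3⟩
    refine ⟨1 - (z.1 - P.1), z.1 - P.1, by linarith, by linarith, by ring, ?_⟩
    ext
    · simp only [toPlane, Prod.smul_mk, Prod.mk_add_mk, smul_eq_mul]; push_cast; ring
    · simp only [toPlane, Prod.smul_mk, Prod.mk_add_mk, smul_eq_mul]; rw [h1]; ring

theorem mem_segment_vertical (P : ℤ × ℤ) (z : ℝ × ℝ) :
    z ∈ segment ℝ (toPlane P) (toPlane (P.1, P.2 + 1)) ↔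
      z.1 = P.1 ∧ (P.2 : ℝ) ≤ z.2 ∧ z.2 ≤ P.2 + 1 := by
  constructor
  · rintro ⟨s, t, hs, ht, hst, rfl⟩
    have hs' : s = 1 - t := by linarith
    subst hs'
    simp only [toPlane, Prod.smul_mk, Prod.mk_add_mk, smul_eq_mul]
    push_cast
    refine ⟨?_, ?_, ?_⟩ <;> linarith
  · rintro ⟨h1, h2, h3⟩
    refine ⟨1 - (z.2 - P.2), z.2 - P.2, by linarith, by linarith, by ring, ?_⟩
    ext
    · simp only [toPlane, Prod.smul_mk, Prod.mk_add_mk, smul_eq_mul]; rw [h1]; ring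
    · simp only [toPlane, Prod.smul_mk, Prod.mk_add_mk, smul_eq_mul]; push_cast; ring

theorem HorizontalStep.mem_curve {P : ℤ × ℤ} (h : HorizontalStep pt d P) {z : ℝ × ℝ}
    (h1 : z.2 = P.2) (h2 : (P.1 : ℝ) ≤ z.1) (h3 : z.1 ≤ P.1 + 1) : z ∈ latticeCurve pt d := by
  obtain ⟨v, hv, ⟨h, h'⟩ | ⟨h, h'⟩⟩ := h <;> refine Set.mem_iUnion₂.2 ⟨v, hv, ?_⟩ <;> rw [h, h']
  · exact (mem_segment_horizontal P z).2 ⟨h1, h2, h3⟩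
  · rw [segment_symm]
    exact (mem_segment_horizontal P z).2 ⟨h1, h2, h3⟩

theorem VerticalStep.mem_curve {P : ℤ × ℤ} (h : VerticalStep pt d P) {z : ℝ × ℝ}
    (h1 : z.1 = P.1) (h2 : (P.2 : ℝ) ≤ z.2) (h3 : z.2 ≤ P.2 + 1) : z ∈ latticeCurve pt d := by
  obtain ⟨v, hv, ⟨h, h'⟩ | ⟨h, h'⟩⟩ := h <;> refine Set.mem_iUnion₂.2 ⟨v, hv, ?_⟩ <;> rw [h, h']
  · exact (mem_segment_vertical P z).2 ⟨h1, h2, h3⟩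
  · rw [segment_symm]
    exact (mem_segment_vertical P z).2 ⟨h1, h2, h3⟩

theorem LatticeAdj.cases {u v : ℤ × ℤ} (h : LatticeAdj u v) :
    v = (u.1, u.2 + 1) ∨ u = (v.1, v.2 + 1) ∨ v = (u.1 + 1, u.2) ∨ u = (v.1 + 1, v.2) := by
  simp only [LatticeAdj, Prod.ext_iff] at *
  omega

theorem exists_step_of_mem_curve (hadj : ∀ v ∈ d.support, LatticeAdj (pt v) (pt (d v)))
    {z : ℝ × ℝ} (hz : z ∈ latticeCurve pt d) :
    (∃ P, HorizontalStep pt d P ∧ z.2 = P.2 ∧ (P.1 : ℝ) ≤ z.1 ∧ z.1 ≤ P.1 + 1) ∨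
      (∃ P, VerticalStep pt d P ∧ z.1 = P.1 ∧ (P.2 : ℝ) ≤ z.2 ∧ z.2 ≤ P.2 + 1) := by
  obtain ⟨v, hv, hz⟩ := Set.mem_iUnion₂.1 hz
  rcases (hadj v hv).cases with h | h | h | h <;> rw [h] at hz
  · exact Or.inr ⟨pt v, ⟨v, hv, Or.inl ⟨rfl, h⟩⟩, (mem_segment_vertical _ _).1 hz⟩
  · rw [segment_symm] at hz
    exact Or.inr ⟨pt (d v), ⟨v, hv, Or.inr ⟨rfl, h⟩⟩, (mem_segment_vertical _ _).1 hz⟩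
  · exact Or.inl ⟨pt v, ⟨v, hv, Or.inl ⟨rfl, h⟩⟩, (mem_segment_horizontal _ _).1 hz⟩
  · rw [segment_symm] at hz
    exact Or.inl ⟨pt (d v), ⟨v, hv, Or.inr ⟨rfl, h⟩⟩, (mem_segment_horizontal _ _).1 hz⟩

theorem int_eq_of_half {k j : ℤ} (h1 : (k : ℝ) ≤ j + 1 / 2) (h2 : (j : ℝ) + 1 / 2 ≤ k + 1) :
    k = j := by
  have h3 : (k : ℝ) < j + 1 := by linarith
  have h4 : (j : ℝ) < k + 1 := by linarith
  have h3' : k < j + 1 := by exact_mod_cast h3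
  have h4' : j < k + 1 := by exact_mod_cast h4
  omega

theorem not_int_of_half {k j : ℤ} (h : (j : ℝ) + 1 / 2 = k) : False :=
  int_not_between (k := j) h (by linarith) (by linarith)

theorem connectedComponentIn_eq_of_segment {F : Set (ℝ × ℝ)} {x y : ℝ × ℝ}
    (h : segment ℝ x y ⊆ F) : connectedComponentIn F x = connectedComponentIn F y := by
  apply connectedComponentIn_eq
  exact (convex_segment x y).isPreconnected.subset_connectedComponentIn (left_mem_segment ℝ x y) h
    (right_mem_segment ℝ x y)

theorem mem_segment_bounds {x y z : ℝ × ℝ} (h : z ∈ segment ℝ x y) :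
    ∃ t : ℝ, 0 ≤ t ∧ t ≤ 1 ∧ z.1 = x.1 + t * (y.1 - x.1) ∧ z.2 = x.2 + t * (y.2 - x.2) := by
  obtain ⟨s, t, hs, ht, hst, rfl⟩ := h
  have hs' : s = 1 - t := by linarith
  subst hs'
  refine ⟨t, ht, by linarith, ?_, ?_⟩ <;> simp <;> ring

section Component

variable (hadj : ∀ v ∈ d.support, LatticeAdj (pt v) (pt (d v)))
include hadj

/-- The segment joining the two centres meets the lattice lines only in the common edge of the
cells. -/
theorem cellComponent_left {i j : ℤ} (h : ¬ VerticalStep pt d (i, j)) :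
    cellComponent pt d (i - 1, j) = cellComponent pt d (i, j) := by
  apply connectedComponentIn_eq_of_segment
  intro z hz hzc
  obtain ⟨t, ht0, ht1, e1, e2⟩ := mem_segment_bounds hz
  simp only [cellCentre] at e1 e2
  push_cast at e1
  rw [sub_self, mul_zero, add_zero] at e2
  rcases exists_step_of_mem_curve hadj hzc with ⟨P, hP, h1, h2, h3⟩ | ⟨P, hP, h1, h2, h3⟩
  · exact not_int_of_half (e2.symm.trans h1)
  · rw [e2] at h2 h3
    have hj := int_eq_of_half h2 h3
    have hi : P.1 = i := by
      have : z.1 - 1 / 2 = (i : ℝ) - 1 + t := by rw [e1]; ring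
      apply int_eq_of_half <;> linarith
    exact h (by rwa [← hi, ← hj])

theorem cellComponent_below {i j : ℤ} (h : ¬ HorizontalStep pt d (i, j)) :
    cellComponent pt d (i, j - 1) = cellComponent pt d (i, j) := by
  apply connectedComponentIn_eq_of_segment
  intro z hz hzc
  obtain ⟨t, ht0, ht1, e2, e1⟩ := mem_segment_bounds hz
  simp only [cellCentre] at e1 e2
  push_cast at e1
  rw [sub_self, mul_zero, add_zero] at e2
  rcases exists_step_of_mem_curve hadj hzc with ⟨P, hP, h1, h2, h3⟩ | ⟨P, hP, h1, h2, h3⟩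
  · rw [e2] at h2 h3
    have hj := int_eq_of_half h2 h3
    have hi : P.2 = j := by
      have : z.2 - 1 / 2 = (j : ℝ) - 1 + t := by rw [e1]; ring
      apply int_eq_of_half <;> linarith
    exact h (by rwa [← hi, ← hj])
  · exact not_int_of_half (e2.symm.trans h1)

omit hadj in
theorem HorizontalStep.mem {P : ℤ × ℤ} (h : HorizontalStep pt d P) {x : ℤ} (hx : P.1 ≤ x)
    (hx' : x ≤ P.1 + 1) : ∃ v ∈ d.support, pt v = (x, P.2) := by
  obtain ⟨v, hv, h⟩ := h
  have hdv : d v ∈ d.support := Equiv.Perm.apply_mem_support.2 hv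
  have hcase : x = P.1 ∨ x = P.1 + 1 := by omega
  rcases hcase with rfl | rfl <;> rcases h with ⟨h1, h2⟩ | ⟨h1, h2⟩
  exacts [⟨v, hv, h1⟩, ⟨_, hdv, h1⟩, ⟨_, hdv, h2⟩, ⟨v, hv, h2⟩]

omit hadj in
theorem VerticalStep.mem {P : ℤ × ℤ} (h : VerticalStep pt d P) {y : ℤ} (hy : P.2 ≤ y)
    (hy' : y ≤ P.2 + 1) : ∃ v ∈ d.support, pt v = (P.1, y) := by
  obtain ⟨v, hv, h⟩ := h
  have hdv : d v ∈ d.support := Equiv.Perm.apply_mem_support.2 hv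
  have hcase : y = P.2 ∨ y = P.2 + 1 := by omega
  rcases hcase with rfl | rfl <;> rcases h with ⟨h1, h2⟩ | ⟨h1, h2⟩
  exacts [⟨v, hv, h1⟩, ⟨_, hdv, h1⟩, ⟨_, hdv, h2⟩, ⟨v, hv, h2⟩]

/-- Beyond `P`, the diagonal segment to the cell centre has no integral coordinate, so only `P`
itself could be on the curve. -/
theorem component_toPlane {P : ℤ × ℤ} (h : ∀ v ∈ d.support, pt v ≠ P) :
    connectedComponentIn (latticeCurve pt d)ᶜ (toPlane P) = cellComponent pt d P := by
  apply connectedComponentIn_eq_of_segment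
  intro z hz hzc
  obtain ⟨t, ht0, ht1, e1, e2⟩ := mem_segment_bounds hz
  simp only [cellCentre, toPlane, add_sub_cancel_left] at e1 e2
  have key : ∀ k j : ℤ, (j : ℝ) + t * (1 / 2) = k → k = j ∧ t = 0 := by
    intro k j hk
    have hkj : k = j := by apply int_eq_of_half <;> linarith
    subst hkj
    exact ⟨rfl, by linarith⟩
  rcases exists_step_of_mem_curve hadj hzc with ⟨Q, hQ, h1, h2, h3⟩ | ⟨Q, hQ, h1, h2, h3⟩
  · obtain ⟨hk, rfl⟩ := key _ _ (e2.symm.trans h1)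
    rw [e1, zero_mul, add_zero] at h2 h3
    obtain ⟨v, hv, hv'⟩ := hQ.mem (x := P.1) (by exact_mod_cast h2) (by exact_mod_cast h3)
    exact h v hv (by rw [hv', hk])
  · obtain ⟨hk, rfl⟩ := key _ _ (e1.symm.trans h1)
    rw [e2, zero_mul, add_zero] at h2 h3
    obtain ⟨v, hv, hv'⟩ := hQ.mem (y := P.2) (by exact_mod_cast h2) (by exact_mod_cast h3)
    exact h v hv (by rw [hv', hk])

theorem cellCentre_notMem_curve (P : ℤ × ℤ) : cellCentre P ∈ (latticeCurve pt d)ᶜ := by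
  intro hzc
  rcases exists_step_of_mem_curve hadj hzc with ⟨Q, hQ, h1, h2, h3⟩ | ⟨Q, hQ, h1, h2, h3⟩
  · exact not_int_of_half h1
  · exact not_int_of_half h1

theorem toPlane_mem_curve_iff (P : ℤ × ℤ) :
    toPlane P ∈ latticeCurve pt d ↔ ∃ v ∈ d.support, pt v = P := by
  constructor
  · intro hzc
    rcases exists_step_of_mem_curve hadj hzc with ⟨Q, hQ, h1, h2, h3⟩ | ⟨Q, hQ, h1, h2, h3⟩ <;>
      simp only [toPlane] at h1 h2 h3
    · obtain ⟨v, hv, hv'⟩ := hQ.mem (x := P.1) (Int.cast_le.1 h2) (by exact_mod_cast h3)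
      exact ⟨v, hv, by rw [hv', ← Int.cast_injective h1]⟩
    · obtain ⟨v, hv, hv'⟩ := hQ.mem (y := P.2) (Int.cast_le.1 h2) (by exact_mod_cast h3)
      exact ⟨v, hv, by rw [hv', ← Int.cast_injective h1]⟩
  · rintro ⟨v, hv, rfl⟩
    exact Set.mem_iUnion₂.2 ⟨v, hv, left_mem_segment ℝ _ _⟩

theorem not_isBounded_cellComponent_of_top {i j : ℤ}
    (h : ∀ k, j < k → ¬ HorizontalStep pt d (i, k)) :
    ¬ Bornology.IsBounded (cellComponent pt d (i, j)) := by
  let S : Set (ℝ × ℝ) := {((i : ℝ) + 1 / 2)} ×ˢ Set.Ici ((j : ℝ) + 1 / 2)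
  have hS : S ⊆ cellComponent pt d (i, j) := by
    apply IsPreconnected.subset_connectedComponentIn
    · exact isPreconnected_singleton.prod isPreconnected_Ici
    · exact ⟨rfl, le_refl ((j : ℝ) + 1 / 2)⟩
    · rintro ⟨x, y⟩ ⟨hx, hy⟩ hzc
      simp only [Set.mem_singleton_iff, Set.mem_Ici] at hx hy
      rcases exists_step_of_mem_curve hadj hzc with ⟨P, hP, h1, h2, h3⟩ | ⟨P, hP, h1, h2, h3⟩
      · simp only at h1 h2 h3
        rw [hx] at h2 h3
        have hi := int_eq_of_half h2 h3
        apply h P.2 _ (by rwa [← hi])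
        have : (j : ℝ) < P.2 := by linarith
        exact_mod_cast this
      · exact not_int_of_half (hx.symm.trans h1)
  intro hb
  have hb' := (hb.subset hS).image_snd
  have himg : Prod.snd '' S = Set.Ici ((j : ℝ) + 1 / 2) :=
    Set.snd_image_prod (Set.singleton_nonempty _) _
  rw [himg] at hb'
  obtain ⟨M, hM⟩ := hb'.bddAbove
  have h1 := hM (Set.mem_Ici.2 (le_max_left ((j : ℝ) + 1 / 2) (M + 1)))
  have h2 := le_max_right ((j : ℝ) + 1 / 2) (M + 1)
  linarith

theorem cellComponent_eq_of_column {i j : ℤ} (k : ℕ)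
    (h : ∀ r < k, ¬ HorizontalStep pt d (i, j + 1 + r)) :
    cellComponent pt d (i, j) = cellComponent pt d (i, j + k) := by
  induction k with
  | zero => simp
  | succ k ih =>
    rw [ih fun r hr => h r (by omega), ← cellComponent_below hadj (i := i) (j := j + (k + 1 : ℕ))]
    · rw [Nat.cast_succ, ← add_assoc, add_sub_cancel_right]
    · have := h k (by omega)
      rwa [Nat.cast_succ, add_comm (k : ℤ) 1, ← add_assoc]

end Component

end Curve

/-! ### Crossing parity and boundedness -/

section Parity

variable {V : Type*} [Fintype V] [DecidableEq V] {pt : V → ℤ × ℤ} {d : Equiv.Perm V}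

theorem sum_support_apply {M : Type*} [AddCommMonoid M] (d : Equiv.Perm V) (f : V → M) :
    ∑ v ∈ d.support, f (d v) = ∑ v ∈ d.support, f v := by
  apply Finset.sum_bij (fun v _ => d v)
  · intro v hv
    exact Equiv.Perm.apply_mem_support.2 hv
  · intro v _ w _ h
    exact d.injective h
  · intro v hv
    refine ⟨d⁻¹ v, ?_, by simp⟩
    rw [← Equiv.Perm.apply_mem_support]
    simpa using hv
  · intro v _
    rfl

theorem sum_support_telescope (d : Equiv.Perm V) (f : V → ZMod 2) :
    ∑ v ∈ d.support, (f v + f (d v)) = 0 := by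
  rw [Finset.sum_add_distrib, sum_support_apply, CharTwo.add_self_eq_zero]

theorem cycleParity_below (i j : ℤ) :
    cycleParity pt d (i, j - 1) = cycleParity pt d (i, j) +
      ∑ v ∈ d.support, onHorizontal (i, j) (pt v) (pt (d v)) := by
  simp only [cycleParity, crossing_below, Finset.sum_add_distrib]

theorem sum_onHorizontal_eq_zero {P : ℤ × ℤ} (h : ¬ HorizontalStep pt d P) :
    ∑ v ∈ d.support, onHorizontal P (pt v) (pt (d v)) = 0 := by
  apply Finset.sum_eq_zero
  intro v hv
  rw [onHorizontal, if_neg]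
  rintro ⟨h1, h2, h3⟩
  refine h ⟨v, hv, ?_⟩
  simp only [Prod.ext_iff]
  omega

theorem sum_onVertical_eq_zero {P : ℤ × ℤ} (h : ¬ VerticalStep pt d P) :
    ∑ v ∈ d.support, onVertical P (pt v) (pt (d v)) = 0 := by
  apply Finset.sum_eq_zero
  intro v hv
  rw [onVertical, if_neg]
  rintro ⟨h1, h2, h3⟩
  refine h ⟨v, hv, ?_⟩
  simp only [Prod.ext_iff]
  omega

section Adj

variable (hadj : ∀ v ∈ d.support, LatticeAdj (pt v) (pt (d v)))
include hadj

theorem cycleParity_left (i j : ℤ) :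
    cycleParity pt d (i - 1, j) = cycleParity pt d (i, j) +
      ∑ v ∈ d.support, onVertical (i, j) (pt v) (pt (d v)) := by
  simp only [cycleParity]
  rw [Finset.sum_congr rfl fun v hv => crossing_left (hadj v hv) i j, Finset.sum_add_distrib,
    Finset.sum_add_distrib,
    sum_support_telescope d (fun v => if (pt v).1 = i ∧ j < (pt v).2 then 1 else 0), add_zero]

/-- From below the cycle the ray meets every step across its column, and a closed curve crosses a
vertical line an even number of times. -/
theorem cycleParity_eq_zero_of_forall_lt {P : ℤ × ℤ} (h : ∀ v ∈ d.support, P.2 < (pt v).2) :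
    cycleParity pt d P = 0 := by
  rw [cycleParity, ← sum_support_telescope d (fun v => if (pt v).1 ≤ P.1 then 1 else 0)]
  apply Finset.sum_congr rfl
  intro v hv
  have h1 := h v hv
  have h2 := hadj v hv
  simp only [LatticeAdj] at h2
  unfold crossing
  split_ifs <;> first | rfl | (exfalso; omega)

theorem exists_bound_of_cycleParity_ne_zero :
    ∃ M : ℤ, ∀ P, cycleParity pt d P ≠ 0 → |P.1| ≤ M ∧ |P.2| ≤ M := by
  -- A crude bound dominating each vertex. An arc met by the ray bounds `P.1`, and `P.2` from above;
  -- a vertex not above `P` bounds `P.2` from below. The summand 1 allows `P` to be one column to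
  -- the left of a vertex.
  refine ⟨∑ v ∈ d.support, (|(pt v).1| + |(pt v).2| + 1), ?_⟩
  intro P hP
  have hle : ∀ v ∈ d.support, |(pt v).1| + |(pt v).2| + 1 ≤
      ∑ v ∈ d.support, (|(pt v).1| + |(pt v).2| + 1) := fun v hv =>
    Finset.single_le_sum (f := fun v => |(pt v).1| + |(pt v).2| + 1)
      (fun v _ => by positivity) hv
  have h1 : ∃ v ∈ d.support, crossing P (pt v) (pt (d v)) ≠ 0 := by
    by_contra! h
    exact hP (Finset.sum_eq_zero h)
  have h2 : ∃ v ∈ d.support, (pt v).2 ≤ P.2 := by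
    by_contra! h
    exact hP (cycleParity_eq_zero_of_forall_lt hadj h)
  obtain ⟨v, hv, hv'⟩ := h1
  obtain ⟨w, hw, hw'⟩ := h2
  have hv2 : (pt v).2 = (pt (d v)).2 ∧ P.2 < (pt v).2 ∧
      (((pt v).1 = P.1 ∧ (pt (d v)).1 = P.1 + 1) ∨
        ((pt (d v)).1 = P.1 ∧ (pt v).1 = P.1 + 1)) := by
    by_contra h
    exact hv' (if_neg h)
  have l1 := hle v hv
  have l2 := hle w hw
  have := abs_le.1 (le_refl |(pt v).1|)
  have := abs_le.1 (le_refl |(pt v).2|)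
  have := abs_le.1 (le_refl |(pt w).1|)
  have := abs_le.1 (le_refl |(pt w).2|)
  have := abs_nonneg (pt v).1
  have := abs_nonneg (pt w).1
  have := abs_nonneg (pt w).2
  have := abs_nonneg (pt v).2
  rw [abs_le, abs_le]
  omega

omit hadj in
theorem eventually_floor (x : ℝ) :
    ∀ᶠ y : ℝ in nhds x, ⌊y⌋ = ⌊x⌋ ∨ (x = ⌊x⌋ ∧ ⌊y⌋ = ⌊x⌋ - 1) := by
  have h1 : ∀ᶠ y : ℝ in nhds x, y < ⌊x⌋ + 1 := eventually_lt_nhds (Int.lt_floor_add_one x)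
  rcases (Int.floor_le x).lt_or_eq with h | h
  · have h2 : ∀ᶠ y : ℝ in nhds x, (⌊x⌋ : ℝ) < y := eventually_gt_nhds h
    filter_upwards [h1, h2] with y hy1 hy2
    exact Or.inl (Int.floor_eq_iff.2 ⟨hy2.le, hy1⟩)
  · have h2 : ∀ᶠ y : ℝ in nhds x, (⌊x⌋ : ℝ) - 1 < y := eventually_gt_nhds (by linarith)
    filter_upwards [h1, h2] with y hy1 hy2
    rcases le_or_gt (⌊x⌋ : ℝ) y with h3 | h3
    · exact Or.inl (Int.floor_eq_iff.2 ⟨h3, hy1⟩)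
    · refine Or.inr ⟨h.symm, Int.floor_eq_iff.2 ⟨?_, ?_⟩⟩ <;> push_cast <;> linarith

/-- Near a point the cell changes only across lattice edges through that point. Off the curve these
edges are not used by the cycle, so the parity is locally constant. -/
theorem continuousOn_cycleParity_floor :
    ContinuousOn (fun z : ℝ × ℝ => cycleParity pt d (⌊z.1⌋, ⌊z.2⌋)) (latticeCurve pt d)ᶜ := by
  rintro ⟨x, y⟩ hz
  apply ContinuousAt.continuousWithinAt
  apply ContinuousAt.congr (f := fun _ => cycleParity pt d (⌊x⌋, ⌊y⌋)) continuousAt_const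
  have hx := (continuous_fst.tendsto (x, y)).eventually (eventually_floor x)
  have hy := (continuous_snd.tendsto (x, y)).eventually (eventually_floor y)
  have hfx := Int.floor_le x
  have hfx' := (Int.lt_floor_add_one x).le
  have hfy := Int.floor_le y
  have hfy' := (Int.lt_floor_add_one y).le
  have e1 : y = ⌊y⌋ → ∀ i : ℤ, (i : ℝ) ≤ x → x ≤ i + 1 →
      cycleParity pt d (i, ⌊y⌋ - 1) = cycleParity pt d (i, ⌊y⌋) := by
    intro h i hi hi'
    rw [cycleParity_below, sum_onHorizontal_eq_zero, add_zero]
    intro hs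
    exact hz (hs.mem_curve h hi hi')
  have e2 : x = ⌊x⌋ → cycleParity pt d (⌊x⌋ - 1, ⌊y⌋) = cycleParity pt d (⌊x⌋, ⌊y⌋) := by
    intro h
    rw [cycleParity_left hadj, sum_onVertical_eq_zero, add_zero]
    intro hs
    exact hz (hs.mem_curve h hfy hfy')
  filter_upwards [hx, hy] with z h1 h2
  rcases h1 with h1 | ⟨h1, h1'⟩ <;> rcases h2 with h2 | ⟨h2, h2'⟩
  · rw [h1, h2]
  · rw [h1, h2', e1 h2 _ hfx hfx']
  · rw [h1', h2, e2 h1]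
  · rw [h1', h2', e1 h2, e2 h1] <;> push_cast <;> linarith

omit hadj in
theorem floor_cellCentre (P : ℤ × ℤ) : (⌊(cellCentre P).1⌋, ⌊(cellCentre P).2⌋) = P := by
  have h : ∀ k : ℤ, ⌊(k : ℝ) + 1 / 2⌋ = k := by
    intro k
    rw [Int.floor_eq_iff]
    constructor <;> linarith
  exact Prod.ext (h _) (h _)

theorem cycleParity_floor_of_mem {P : ℤ × ℤ} {z : ℝ × ℝ} (hz : z ∈ cellComponent pt d P) :
    cycleParity pt d (⌊z.1⌋, ⌊z.2⌋) = cycleParity pt d P := by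
  have h := isPreconnected_connectedComponentIn.constant
    ((continuousOn_cycleParity_floor hadj).mono
      (connectedComponentIn_subset _ (cellCentre P))) hz
    (mem_connectedComponentIn (cellCentre_notMem_curve hadj P))
  rwa [floor_cellCentre] at h

theorem cycleParity_eq_of_cellComponent_eq {P Q : ℤ × ℤ}
    (h : cellComponent pt d P = cellComponent pt d Q) :
    cycleParity pt d P = cycleParity pt d Q := by
  have hP := mem_connectedComponentIn (cellCentre_notMem_curve (pt := pt) hadj P)
  change cellCentre P ∈ cellComponent pt d P at hP
  rw [h] at hP
  rw [← cycleParity_floor_of_mem hadj hP, floor_cellCentre]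

theorem isBounded_cellComponent {P : ℤ × ℤ} (h : cycleParity pt d P ≠ 0) :
    Bornology.IsBounded (cellComponent pt d P) := by
  obtain ⟨M, hM⟩ := exists_bound_of_cycleParity_ne_zero hadj
  have hsub : cellComponent pt d P ⊆
      Set.Icc (-(M : ℝ)) (M + 1) ×ˢ Set.Icc (-(M : ℝ)) (M + 1) := by
    intro z hz
    obtain ⟨h1, h2⟩ := hM (⌊z.1⌋, ⌊z.2⌋) (by rwa [cycleParity_floor_of_mem hadj hz])
    rw [abs_le] at h1 h2
    have key : ∀ x : ℝ, -M ≤ ⌊x⌋ → ⌊x⌋ ≤ M → x ∈ Set.Icc (-(M : ℝ)) (M + 1) := by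
      intro x h1 h2
      have h1' : (-M : ℝ) ≤ ⌊x⌋ := by exact_mod_cast h1
      have h2' : (⌊x⌋ : ℝ) ≤ M := by exact_mod_cast h2
      have := Int.floor_le x
      have := Int.lt_floor_add_one x
      constructor <;> linarith
    exact ⟨key _ h1.1 h1.2, key _ h2.1 h2.2⟩
  exact ((Metric.isBounded_Icc _ _).prod (Metric.isBounded_Icc _ _)).subset hsub

end Adj

/-! ### The two sides of a lattice cycle -/

section Cycle

variable (hpt : Function.Injective pt) (hd : d.IsCycle)
  (hadj : ∀ v ∈ d.support, LatticeAdj (pt v) (pt (d v)))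
include hpt hadj

omit hadj in
-- By injectivity of `d` and `pt`, the only arcs at `pt (d v)` come from `v` or go to `d (d v)`; the
-- other edges there are free to cross.
theorem turn_of_step (v : V) :
    (pt v ≠ ((pt (d v)).1, (pt (d v)).2 + 1) → pt (d (d v)) ≠ ((pt (d v)).1, (pt (d v)).2 + 1) →
      ¬ VerticalStep pt d (pt (d v))) ∧
    (pt v ≠ ((pt (d v)).1 - 1, (pt (d v)).2) → pt (d (d v)) ≠ ((pt (d v)).1 - 1, (pt (d v)).2) →
      ¬ HorizontalStep pt d ((pt (d v)).1 - 1, (pt (d v)).2)) ∧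
    (pt v ≠ ((pt (d v)).1, (pt (d v)).2 - 1) → pt (d (d v)) ≠ ((pt (d v)).1, (pt (d v)).2 - 1) →
      ¬ VerticalStep pt d ((pt (d v)).1, (pt (d v)).2 - 1)) ∧
    (pt v ≠ ((pt (d v)).1 + 1, (pt (d v)).2) → pt (d (d v)) ≠ ((pt (d v)).1 + 1, (pt (d v)).2) →
      ¬ HorizontalStep pt d (pt (d v))) := by
  have key : ∀ P, pt v ≠ P → pt (d (d v)) ≠ P →
      ∀ x, ¬ ((pt x = pt (d v) ∧ pt (d x) = P) ∨ (pt (d x) = pt (d v) ∧ pt x = P)) := by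
    rintro P h1 h2 x (⟨h3, h4⟩ | ⟨h3, h4⟩)
    · rw [hpt h3] at h4
      exact h2 h4
    · rw [d.injective (hpt h3)] at h4
      exact h1 h4
  refine ⟨?_, ?_, ?_, ?_⟩
  · rintro h1 h2 ⟨x, hx, h⟩
    exact key _ h1 h2 x h
  · rintro h1 h2 ⟨x, hx, h⟩
    rw [sub_add_cancel] at h
    exact key _ h1 h2 x (by tauto)
  · rintro h1 h2 ⟨x, hx, h⟩
    rw [sub_add_cancel] at h
    exact key _ h1 h2 x (by tauto)
  · rintro h1 h2 ⟨x, hx, h⟩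
    exact key _ h1 h2 x h

theorem cellComponent_turn {v : V} (hv : v ∈ d.support) :
    cellComponent pt d (leftCell (pt v) (pt (d v))) =
      cellComponent pt d (leftCell (pt (d v)) (pt (d (d v)))) ∧
    cellComponent pt d (leftCell (pt (d v)) (pt v)) =
      cellComponent pt d (leftCell (pt (d (d v))) (pt (d v))) ∧
    (cellComponent pt d (pt (d v)) =
        cellComponent pt d (leftCell (pt (d v)) (pt (d (d v)))) ∨
      cellComponent pt d (pt (d v)) =
        cellComponent pt d (leftCell (pt (d (d v))) (pt (d v)))) := by
  have hdv := Equiv.Perm.apply_mem_support.2 hv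
  obtain ⟨hN, hW, hS, hE⟩ := turn_of_step (d := d) hpt v
  have t := leftCell_eq_of_turn (cellComponent pt d) (hadj v hv) (hadj _ hdv)
    (fun h1 h2 => cellComponent_left hadj (hN h1 h2))
    (fun h1 h2 => cellComponent_below hadj (hW h1 h2))
    (fun h1 h2 => cellComponent_left hadj (hS h1 h2))
    (fun h1 h2 => cellComponent_below hadj (hE h1 h2))
  have t' := leftCell_eq_of_turn (cellComponent pt d) (hadj _ hdv).symm (hadj v hv).symm
    (fun h1 h2 => cellComponent_left hadj (hN h2 h1))
    (fun h1 h2 => cellComponent_below hadj (hW h2 h1))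
    (fun h1 h2 => cellComponent_left hadj (hS h2 h1))
    (fun h1 h2 => cellComponent_below hadj (hE h2 h1))
  exact ⟨t.1, t'.1.symm, t.2⟩

include hd

theorem cellComponent_leftCell_const {v w : V} (hv : v ∈ d.support) (hw : w ∈ d.support) :
    cellComponent pt d (leftCell (pt v) (pt (d v))) =
      cellComponent pt d (leftCell (pt w) (pt (d w))) ∧
    cellComponent pt d (leftCell (pt (d v)) (pt v)) =
      cellComponent pt d (leftCell (pt (d w)) (pt w)) := by
  obtain ⟨k, rfl⟩ := hd.exists_pow_eq (Equiv.Perm.mem_support.1 hv) (Equiv.Perm.mem_support.1 hw)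
  clear hw
  induction k with
  | zero => exact ⟨rfl, rfl⟩
  | succ k ih =>
    have hk : (d ^ k) v ∈ d.support := Equiv.Perm.pow_apply_mem_support.2 hv
    obtain ⟨t1, t2, _⟩ := cellComponent_turn hpt hadj hk
    rw [pow_succ', Equiv.Perm.mul_apply]
    exact ⟨ih.1.trans t1, ih.2.trans t2⟩

omit hpt hd in
-- Climb the column from `P` to the first horizontal step of the cycle: the cell just below it is to
-- the left or right of that arc.
theorem cellComponent_cases (P : ℤ × ℤ) :
    (∀ k, P.2 < k → ¬ HorizontalStep pt d (P.1, k)) ∨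
      ∃ v ∈ d.support, cellComponent pt d P = cellComponent pt d (leftCell (pt v) (pt (d v))) ∨
        cellComponent pt d P = cellComponent pt d (leftCell (pt (d v)) (pt v)) := by
  classical
  by_cases h : ∃ k : ℕ, HorizontalStep pt d (P.1, P.2 + 1 + k)
  · right
    have hcol := cellComponent_eq_of_column hadj (Nat.find h)
      (fun r hr => Nat.find_min h hr)
    obtain ⟨v, hv, hs⟩ := Nat.find_spec h
    refine ⟨v, hv, ?_⟩
    rw [hcol]
    rcases hs with ⟨h1, h2⟩ | ⟨h1, h2⟩
    · right
      rw [h1, h2]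
      congr 1
      simp only [leftCell, Prod.mk.injEq]
      omega
    · left
      rw [h1, h2]
      congr 1
      simp only [leftCell, Prod.mk.injEq]
      omega
  · left
    intro k hk hs
    apply h
    refine ⟨(k - P.2 - 1).toNat, ?_⟩
    rw [Int.toNat_of_nonneg (by omega)]
    convert hs using 2
    ring

omit hd in
-- The edge between the two cells is used by exactly one arc, because `hdd` excludes a doubled edge;
-- crossing it flips the parity.
theorem cycleParity_leftCell {v : V} (hv : v ∈ d.support) (hdd : d (d v) ≠ v) :
    cycleParity pt d (leftCell (pt v) (pt (d v))) =
      cycleParity pt d (leftCell (pt (d v)) (pt v)) + 1 := by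
  have hH : ∀ P : ℤ × ℤ, (pt v = P ∧ pt (d v) = (P.1 + 1, P.2)) ∨
      (pt (d v) = P ∧ pt v = (P.1 + 1, P.2)) →
      ∑ w ∈ d.support, onHorizontal P (pt w) (pt (d w)) = 1 := by
    intro P hP
    rw [Finset.sum_eq_single_of_mem v hv]
    · rw [onHorizontal, if_pos]
      rcases hP with ⟨h1, h2⟩ | ⟨h1, h2⟩ <;> rw [h1, h2] <;> simp
    · intro w hw hwv
      rw [onHorizontal, if_neg]
      rintro ⟨h1, h2, h3⟩
      have : (pt w = pt v ∧ pt (d w) = pt (d v)) ∨ (pt w = pt (d v) ∧ pt (d w) = pt v) := by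
        simp only [Prod.ext_iff] at *
        omega
      rcases this with ⟨h4, h5⟩ | ⟨h4, h5⟩
      · exact hwv (hpt h4)
      · rw [hpt h4] at h5
        exact hdd (hpt h5)
  have hV : ∀ P : ℤ × ℤ, (pt v = P ∧ pt (d v) = (P.1, P.2 + 1)) ∨
      (pt (d v) = P ∧ pt v = (P.1, P.2 + 1)) →
      ∑ w ∈ d.support, onVertical P (pt w) (pt (d w)) = 1 := by
    intro P hP
    rw [Finset.sum_eq_single_of_mem v hv]
    · rw [onVertical, if_pos]
      rcases hP with ⟨h1, h2⟩ | ⟨h1, h2⟩ <;> rw [h1, h2] <;> simp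
    · intro w hw hwv
      rw [onVertical, if_neg]
      rintro ⟨h1, h2, h3⟩
      have : (pt w = pt v ∧ pt (d w) = pt (d v)) ∨ (pt w = pt (d v) ∧ pt (d w) = pt v) := by
        simp only [Prod.ext_iff] at *
        omega
      rcases this with ⟨h4, h5⟩ | ⟨h4, h5⟩
      · exact hwv (hpt h4)
      · rw [hpt h4] at h5
        exact hdd (hpt h5)
  have two : (1 : ZMod 2) + 1 = 0 := CharTwo.add_self_eq_zero 1
  rcases (hadj v hv).cases with h | h | h | h
  · have e1 : leftCell (pt v) (pt (d v)) = ((pt v).1 - 1, (pt v).2) := by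
      rw [h]; simp only [leftCell, Prod.mk.injEq]; omega
    have e2 : leftCell (pt (d v)) (pt v) = ((pt v).1, (pt v).2) := by
      rw [h]; simp only [leftCell, Prod.mk.injEq]; omega
    rw [e1, e2, cycleParity_left hadj, hV _ (Or.inl ⟨rfl, h⟩)]
  · have e1 : leftCell (pt v) (pt (d v)) = ((pt (d v)).1, (pt (d v)).2) := by
      rw [h]; simp only [leftCell, Prod.mk.injEq]; omega
    have e2 : leftCell (pt (d v)) (pt v) = ((pt (d v)).1 - 1, (pt (d v)).2) := by
      rw [h]; simp only [leftCell, Prod.mk.injEq]; omega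
    rw [e1, e2, cycleParity_left hadj, hV _ (Or.inr ⟨rfl, h⟩), add_assoc, two, add_zero]
  · have e1 : leftCell (pt v) (pt (d v)) = ((pt v).1, (pt v).2) := by
      rw [h]; simp only [leftCell, Prod.mk.injEq]; omega
    have e2 : leftCell (pt (d v)) (pt v) = ((pt v).1, (pt v).2 - 1) := by
      rw [h]; simp only [leftCell, Prod.mk.injEq]; omega
    rw [e1, e2, cycleParity_below, hH _ (Or.inl ⟨rfl, h⟩), add_assoc, two, add_zero]
  · have e1 : leftCell (pt v) (pt (d v)) = ((pt (d v)).1, (pt (d v)).2 - 1) := by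
      rw [h]; simp only [leftCell, Prod.mk.injEq]; omega
    have e2 : leftCell (pt (d v)) (pt v) = ((pt (d v)).1, (pt (d v)).2) := by
      rw [h]; simp only [leftCell, Prod.mk.injEq]; omega
    rw [e1, e2, cycleParity_below, hH _ (Or.inr ⟨rfl, h⟩)]

/-- The cell above a topmost vertex is unbounded, so one side of the cycle is. That side has parity
zero and the other parity one, so a cell of parity zero with an arc above it belongs to the
unbounded side. -/
theorem not_isBounded_cellComponent {P : ℤ × ℤ} (h : cycleParity pt d P = 0) :
    ¬ Bornology.IsBounded (cellComponent pt d P) := by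
  rcases cellComponent_cases hadj P with hP | ⟨w, hw, hP⟩
  · exact not_isBounded_cellComponent_of_top hadj hP
  have hne : d.support.Nonempty := ⟨w, hw⟩
  obtain ⟨u, hu, hmax⟩ := Finset.exists_max_image d.support (fun v => (pt v).2) hne
  obtain ⟨v, rfl⟩ := d.surjective u
  have hv : v ∈ d.support := Equiv.Perm.apply_mem_support.1 hu
  have htop : ¬ Bornology.IsBounded (cellComponent pt d (pt (d v))) := by
    apply not_isBounded_cellComponent_of_top hadj
    intro k hk hs
    obtain ⟨x, hx, hx'⟩ := hs.mem le_rfl (by simp)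
    have := hmax x hx
    rw [hx'] at this
    simp only at this
    omega
  have hLR : ¬ Bornology.IsBounded (cellComponent pt d (leftCell (pt w) (pt (d w)))) ∨
      ¬ Bornology.IsBounded (cellComponent pt d (leftCell (pt (d w)) (pt w))) := by
    rcases (cellComponent_turn hpt hadj hv).2.2 with h' | h'
    · left
      rwa [← (cellComponent_leftCell_const hpt hd hadj hu hw).1, ← h']
    · right
      rwa [← (cellComponent_leftCell_const hpt hd hadj hu hw).2, ← h']
  -- For a doubled edge the two sides have no distinct parities, but they are joined by turning
  -- around an end.
  by_cases hdd : d (d w) = w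
  · have := (cellComponent_turn hpt hadj hw).1
    rw [hdd] at this
    rw [this] at hLR hP
    rw [or_self] at hLR hP
    rwa [hP]
  · have hp := cycleParity_leftCell hpt hadj hw hdd
    have hL : ∀ Q, ¬ Bornology.IsBounded (cellComponent pt d Q) → cycleParity pt d Q = 0 := by
      intro Q hQ
      by_contra hQ'
      exact hQ (isBounded_cellComponent hadj hQ')
    have h01 : (0 : ZMod 2) ≠ 1 := by decide
    rcases hLR with hLR | hLR <;> rcases hP with hP | hP
    · rwa [hP]
    · rw [cycleParity_eq_of_cellComponent_eq hadj hP] at h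
      rw [hL _ hLR, h, zero_add] at hp
      exact absurd hp h01
    · rw [cycleParity_eq_of_cellComponent_eq hadj hP] at h
      rw [hL _ hLR, h, zero_add] at hp
      exact absurd hp h01
    · rwa [hP]

/-- A lattice point is enclosed by a lattice cycle if and only if it is not on the cycle and has
odd crossing parity. -/
theorem lattice_enclosed_iff (P : ℤ × ℤ) :
    (toPlane P ∉ latticeCurve pt d ∧
      Bornology.IsBounded (connectedComponentIn (latticeCurve pt d)ᶜ (toPlane P))) ↔
    (∀ v ∈ d.support, pt v ≠ P) ∧ cycleParity pt d P ≠ 0 := by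
  rw [toPlane_mem_curve_iff hadj]
  push Not
  refine and_congr_right fun h => ?_
  rw [component_toPlane hadj h]
  exact ⟨fun hb h0 => not_isBounded_cellComponent hpt hd hadj h0 hb,
    isBounded_cellComponent hadj⟩

end Cycle

end Parity

/-! ## The Kasteleyn property of paths and grids -/

section Kasteleyn

variable {V : Type*} [Fintype V] [DecidableEq V]

/-- The sign of the arc `u → v` in the canonical orientation. -/
def PlaneGraph.arcSign (G : PlaneGraph V) (u v : V) : ℤ :=
  if G.label u < G.label v then 1 else -1

/-- The sign of every directed cycle is the product of the signs of its arcs in the canonical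
orientation. -/
def PlaneGraph.IsKasteleyn (G : PlaneGraph V) : Prop :=
  ∀ d : Equiv.Perm V, d.IsCycle → (∀ v ∈ d.support, G.graph.Adj v (d v)) →
    G.cycleSign d = ∏ v ∈ d.support, G.arcSign v (d v)

omit [Fintype V] [DecidableEq V] in
theorem walkSum_map_iterate {M : Type*} [AddCommMonoid M] (g : ℤ × ℤ → ℤ × ℤ → M)
    (pt : V → ℤ × ℤ) (d : V → V) (k : ℕ) (x : V) :
    walkSum g (pt x) ((List.iterate d (d x) k).map pt) (pt (d^[k + 1] x)) =
      ((List.iterate d x (k + 1)).map fun v => g (pt v) (pt (d v))).sum := by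
  induction k generalizing x with
  | zero => simp [walkSum]
  | succ k ih =>
    have := ih (d x)
    simp only [List.iterate, List.map_cons, walkSum, List.sum_cons,
      Function.iterate_succ_apply] at this ⊢
    rw [this]

theorem isChain_map_iterate {r : ℤ × ℤ → ℤ × ℤ → Prop} (pt : V → ℤ × ℤ) {d : Equiv.Perm V}
    (h : ∀ v ∈ d.support, r (pt v) (pt (d v))) (k : ℕ) {x : V} (hx : x ∈ d.support) :
    List.IsChain r (pt x :: ((List.iterate d (d x) k).map pt ++ [pt (d^[k + 1] x)])) := by
  induction k generalizing x with
  | zero => simpa using h x hx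
  | succ k ih =>
    have := ih (Equiv.Perm.apply_mem_support.2 hx)
    simp only [List.iterate, List.map_cons, List.cons_append, List.isChain_cons_cons,
      Function.iterate_succ_apply] at this ⊢
    exact ⟨h x hx, this⟩

/-- The closed walk along a directed cycle, as a list of points. -/
theorem exists_walk (pt : V → ℤ × ℤ) (hpt : Function.Injective pt) {d : Equiv.Perm V}
    (hd : d.IsCycle) : ∃ c t, t ≠ [] ∧ (c :: t).Nodup ∧
      (∀ v, pt v ∈ c :: t ↔ v ∈ d.support) ∧ (∀ P ∈ c :: t, ∃ v ∈ d.support, pt v = P) ∧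
      (∀ r : ℤ × ℤ → ℤ × ℤ → Prop, (∀ v ∈ d.support, r (pt v) (pt (d v))) →
        List.IsChain r (c :: (t ++ [c]))) ∧
      ∀ g : ℤ × ℤ → ℤ × ℤ → ZMod 2,
        walkSum g c t c = ∑ v ∈ d.support, g (pt v) (pt (d v)) := by
  obtain ⟨x, hx⟩ := hd.nonempty_support
  -- A cycle has at least two vertices, so the walk visits `k + 1` vertices besides `x`.
  obtain ⟨k, hk⟩ : ∃ k, d.support.card = k + 1 + 1 :=
    ⟨d.support.card - 2, by have := hd.two_le_card_support; omega⟩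
  have hlist : d.toList x = x :: List.iterate d (d x) (k + 1) := by
    rw [Equiv.Perm.toList, hd.cycleOf_eq (Equiv.Perm.mem_support.1 hx), hk]
    rfl
  have hmem : ∀ v, v ∈ x :: List.iterate d (d x) (k + 1) ↔ v ∈ d.support := by
    intro v
    rw [← hlist, Equiv.Perm.mem_toList_iff]
    constructor
    · rintro ⟨h, h'⟩
      exact h.mem_support_iff.1 h'
    · intro hv
      exact ⟨hd.sameCycle (Equiv.Perm.mem_support.1 hx) (Equiv.Perm.mem_support.1 hv), hx⟩
  have hnd : (x :: List.iterate d (d x) (k + 1)).Nodup := hlist ▸ Equiv.Perm.nodup_toList d x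
  have hend : d^[k + 1 + 1] x = x := by
    rw [← hk, ← Equiv.Perm.coe_pow, ← hd.orderOf, pow_orderOf_eq_one, Equiv.Perm.one_apply]
  refine ⟨pt x, (List.iterate d (d x) (k + 1)).map pt, by simp [List.iterate], ?_, ?_, ?_, ?_, ?_⟩
  · rw [← List.map_cons]
    exact hnd.map hpt
  · intro v
    rw [← List.map_cons, List.mem_map_of_injective hpt, hmem]
  · intro P hP
    rw [← List.map_cons] at hP
    obtain ⟨v, hv, rfl⟩ := List.mem_map.1 hP
    exact ⟨v, (hmem v).1 hv, rfl⟩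
  · intro r hr
    have := isChain_map_iterate pt hr (k + 1) hx
    rwa [hend] at this
  · intro g
    have := walkSum_map_iterate g pt d (k + 1) x
    rw [hend] at this
    rw [this]
    have hfin : d.support = (x :: List.iterate d (d x) (k + 1)).toFinset := by
      ext v
      rw [List.mem_toFinset, hmem]
    rw [hfin, List.sum_toFinset _ hnd]
    rfl

theorem sum_zmod_two_eq_card {ι : Type*} (s : Finset ι) (f : ι → ZMod 2) :
    ∑ i ∈ s, f i = ((s.filter fun i => f i ≠ 0).card : ZMod 2) := by
  have h : ∀ a : ZMod 2, a = if a ≠ 0 then 1 else 0 := by decide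
  rw [← Finset.sum_boole]
  exact Finset.sum_congr rfl fun i _ => h (f i)

/-- A plane graph drawn on all the points of a box of the lattice, with edges of length one and
labels increasing in the boustrophedon order, has the Kasteleyn property. -/
theorem isKasteleyn_of_lattice (G : PlaneGraph V) (pt : V → ℤ × ℤ) (hpt : Function.Injective pt)
    (hpos : ∀ v, G.pos v = toPlane (pt v)) {X Y : Finset ℤ} (hY : ∀ y ∈ Y, 0 ≤ y)
    (hbox : ∀ P, P ∈ X ×ˢ Y ↔ ∃ v, pt v = P)
    (hadj : ∀ u v, G.graph.Adj u v → LatticeAdj (pt u) (pt v))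
    (hlabel : ∀ u v, G.graph.Adj u v → (G.label u < G.label v ↔ descent (pt u) (pt v) = 0)) :
    G.IsKasteleyn := by
  classical
  intro d hd hda
  have hdl : ∀ v ∈ d.support, LatticeAdj (pt v) (pt (d v)) := fun v hv => hadj _ _ (hda v hv)
  -- Each step changes the parity of the coordinate sum. Hence cycles are even, and the clockwise
  -- case of the sign never occurs.
  have heven : Even d.support.card := by
    rw [← ZMod.natCast_eq_zero_iff_even, Finset.card_eq_sum_ones, Nat.cast_sum,
      ← sum_support_telescope d fun v => (((pt v).1 + (pt v).2 : ℤ) : ZMod 2)]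
    apply Finset.sum_congr rfl
    intro v hv
    rw [← Int.cast_add, ← Int.cast_natCast, ZMod.intCast_eq_intCast_iff']
    have := hdl v hv
    simp only [LatticeAdj] at this
    push_cast
    omega
  obtain ⟨c, t, ht, hnd, hmem, hmem', hchain, hsum⟩ := exists_walk pt hpt hd
  have hloop : IsLatticeLoop X Y c t := by
    refine ⟨hnd, ht, hchain _ hdl, ?_⟩
    intro P hP
    obtain ⟨v, _, rfl⟩ := hmem' P hP
    exact (hbox _).2 ⟨v, rfl⟩
  have key := hloop.descent_eq hY
  have henc : enclosedParity X Y c t = (G.numEnclosed d : ZMod 2) := by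
    have hcurve : G.curve d = latticeCurve pt d := by
      simp only [PlaneGraph.curve, latticeCurve, hpos]
    have hset : {v | G.IsEnclosed d v} =
        ↑((Finset.univ.filter fun v => v ∉ d.support).filter
          fun v => cycleParity pt d (pt v) ≠ 0) := by
      ext v
      simp only [Set.mem_ofPred_eq, PlaneGraph.IsEnclosed, Finset.coe_filter, Finset.mem_filter,
        Finset.mem_univ, true_and]
      rw [hcurve, hpos, lattice_enclosed_iff hpt hd hdl]
      refine and_congr_left fun _ => ?_
      constructor
      · intro h hv
        exact h v hv rfl
      · intro h w hw hwv
        exact h (hpt hwv ▸ hw)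
    rw [PlaneGraph.numEnclosed, hset, Set.ncard_coe_finset, ← sum_zmod_two_eq_card]
    -- Since the vertices fill the whole box, counting lattice points off the loop is counting
    -- vertices.
    symm
    apply Finset.sum_bij (fun v _ => pt v)
    · intro v hv
      rw [Finset.mem_filter] at hv ⊢
      exact ⟨(hbox _).2 ⟨v, rfl⟩, by rw [hmem]; exact hv.2⟩
    · intro v _ w _ h
      exact hpt h
    · intro P hP
      rw [Finset.mem_filter] at hP
      obtain ⟨v, rfl⟩ := (hbox _).1 hP.1
      exact ⟨v, by rw [Finset.mem_filter, ← hmem]; exact ⟨Finset.mem_univ _, hP.2⟩, rfl⟩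
    · intro v _
      exact (hsum _).symm
  rw [henc, hsum, sum_zmod_two_eq_card, ← Nat.cast_succ, ZMod.natCast_eq_natCast_iff'] at key
  rw [PlaneGraph.cycleSign, if_neg fun h => Nat.not_odd_iff_even.2 heven h.1]
  have hprod : ∏ v ∈ d.support, G.arcSign v (d v) =
      ∏ v ∈ d.support, if descent (pt v) (pt (d v)) ≠ 0 then -1 else 1 := by
    apply Finset.prod_congr rfl
    intro v hv
    have := hlabel _ _ (hda v hv)
    rw [PlaneGraph.arcSign]
    by_cases h : descent (pt v) (pt (d v)) = 0
    · rw [if_pos (this.2 h), if_neg (not_not.2 h)]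
    · rw [if_neg (fun h' => h (this.1 h')), if_pos h]
  rw [hprod, Finset.prod_ite, Finset.prod_const, Finset.prod_const_one, mul_one]
  apply neg_one_pow_congr
  rw [Nat.even_iff, Nat.even_iff, key]

end Kasteleyn

/-! ### Application to paths and boustrophedon grids -/

theorem isKasteleyn_path (n : ℕ) : (path n).IsKasteleyn := by
  apply isKasteleyn_of_lattice (path n) (fun p => ((p.val : ℤ), 0)) (X := Finset.Ico 0 (n : ℤ))
    (Y := {0})
  · intro p q h
    exact Fin.ext (by simpa using h)
  · intro v
    rfl
  · simp
  · rintro ⟨i, j⟩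
    simp only [Finset.mem_product, Finset.mem_Ico, Finset.mem_singleton, Prod.mk.injEq]
    constructor
    · rintro ⟨⟨h1, h2⟩, h3⟩
      exact ⟨⟨i.toNat, by omega⟩, by simp only; omega, h3.symm⟩
    · rintro ⟨v, h1, h2⟩
      have := v.isLt
      omega
  · intro u v h
    change (SimpleGraph.pathGraph n).Adj u v at h
    rw [SimpleGraph.pathGraph_adj] at h
    simp only [LatticeAdj, true_and]
    omega
  · intro u v h
    change (SimpleGraph.pathGraph n).Adj u v at h
    rw [SimpleGraph.pathGraph_adj] at h
    change u.val + 1 < v.val + 1 ↔ _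
    simp only [descent, true_and]
    split_ifs <;> simp <;> omega

/-- Row `q` occupies the `q`-th block of `ℓ` labels. So labels increase from row to row, and the
subtraction in even rows never truncates. -/
theorem boustrophedon_mem {ℓ p : ℕ} (hp : 1 ≤ p) (hp' : p ≤ ℓ) (q : ℕ) (hq : 1 ≤ q) :
    (q - 1) * ℓ < boustrophedon ℓ p q ∧ boustrophedon ℓ p q ≤ q * ℓ := by
  unfold boustrophedon
  rcases Nat.even_or_odd' q with ⟨s, rfl | rfl⟩
  · obtain ⟨s, rfl⟩ : ∃ s', s = s' + 1 := ⟨s - 1, by omega⟩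
    rw [if_neg (by simp), Nat.mul_div_cancel_left _ two_pos,
      show 2 * (s + 1) * ℓ = (2 * (s + 1) - 1) * ℓ + ℓ by
        rw [show 2 * (s + 1) - 1 = 2 * s + 1 by omega]; ring]
    omega
  · rw [if_pos (by simp), show (2 * s + 1) / 2 = s by omega, Nat.add_sub_cancel,
      show (2 * s + 1) * ℓ = 2 * s * ℓ + ℓ by ring]
    omega

theorem boustrophedon_lt_of_lt {ℓ p p' q q' : ℕ} (hp : 1 ≤ p) (hp' : p ≤ ℓ) (h1 : 1 ≤ p')
    (h2 : p' ≤ ℓ) (hq : 1 ≤ q) (hqq : q < q') :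
    boustrophedon ℓ p q < boustrophedon ℓ p' q' := by
  have b1 := (boustrophedon_mem hp hp' q hq).2
  have b2 := (boustrophedon_mem h1 h2 q' (by omega)).1
  have : q * ℓ ≤ (q' - 1) * ℓ := Nat.mul_le_mul_right _ (by omega)
  omega

theorem boustrophedon_lt_iff {ℓ p p' q : ℕ} (hp : 1 ≤ p) (hp' : p ≤ ℓ) (h1 : 1 ≤ p')
    (h2 : p' ≤ ℓ) (hq : 1 ≤ q) :
    boustrophedon ℓ p q < boustrophedon ℓ p' q ↔ (Odd q ∧ p < p') ∨ (Even q ∧ p' < p) := by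
  have b1 := (boustrophedon_mem hp hp' q hq).1
  have b2 := (boustrophedon_mem h1 h2 q hq).1
  unfold boustrophedon at *
  rcases Nat.even_or_odd q with h | h
  · have h' : ¬ Odd q := Nat.not_odd_iff_even.2 h
    simp only [h, h', if_false, false_and, true_and, false_or] at *
    omega
  · have h' : ¬ Even q := Nat.not_even_iff_odd.2 h
    simp only [h, h', if_true, false_and, true_and, or_false] at *
    omega

theorem isKasteleyn_grid (ℓ m : ℕ) : (grid ℓ m).IsKasteleyn := by
  apply isKasteleyn_of_lattice (grid ℓ m) (fun p => ((p.1.val : ℤ), (p.2.val : ℤ)))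
    (X := Finset.Ico 0 (ℓ : ℤ)) (Y := Finset.Ico 0 (m : ℤ))
  · intro p q h
    simp only [Prod.mk.injEq, Nat.cast_inj] at h
    exact Prod.ext (Fin.ext h.1) (Fin.ext h.2)
  · intro v
    rfl
  · simp
    omega
  · rintro ⟨i, j⟩
    simp only [Finset.mem_product, Finset.mem_Ico, Prod.mk.injEq]
    constructor
    · rintro ⟨⟨h1, h2⟩, h3, h4⟩
      exact ⟨(⟨i.toNat, by omega⟩, ⟨j.toNat, by omega⟩), by simp only; omega, by simp only; omega⟩
    · rintro ⟨v, h1, h2⟩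
      have := v.1.isLt
      have := v.2.isLt
      omega
  · intro u v h
    change (SimpleGraph.pathGraph ℓ □ SimpleGraph.pathGraph m).Adj u v at h
    rw [SimpleGraph.boxProd_adj, SimpleGraph.pathGraph_adj, SimpleGraph.pathGraph_adj] at h
    simp only [LatticeAdj]
    rcases h with ⟨h, h'⟩ | ⟨h, h'⟩ <;> rw [h'] <;> omega
  · rintro ⟨p, q⟩ ⟨p', q'⟩ h
    change (SimpleGraph.pathGraph ℓ □ SimpleGraph.pathGraph m).Adj _ _ at h
    rw [SimpleGraph.boxProd_adj, SimpleGraph.pathGraph_adj, SimpleGraph.pathGraph_adj] at h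
    change boustrophedon ℓ (p.val + 1) (q.val + 1) < boustrophedon ℓ (p'.val + 1) (q'.val + 1) ↔ _
    have hp := p.isLt
    have hp' := p'.isLt
    simp only at h
    simp only [descent]
    rcases h with ⟨h, rfl⟩ | ⟨h | h, rfl⟩
    · rw [boustrophedon_lt_iff (by omega) (by omega) (by omega) (by omega) (by omega),
        Nat.odd_iff, Nat.even_iff]
      split_ifs <;> simp <;> omega
    · have := boustrophedon_lt_of_lt (ℓ := ℓ) (p := p.val + 1) (p' := p.val + 1) (q := q.val + 1)
        (q' := q'.val + 1) (by omega) (by omega) (by omega) (by omega) (by omega) (by omega)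
      split_ifs <;> simp <;> omega
    · have := boustrophedon_lt_of_lt (ℓ := ℓ) (p := p.val + 1) (p' := p.val + 1) (q := q'.val + 1)
        (q' := q.val + 1) (by omega) (by omega) (by omega) (by omega) (by omega) (by omega)
      split_ifs <;> simp <;> omega

/-! ## Loop signs and the oriented Cartesian product -/

section Product

variable {V W : Type*} [Fintype V] [DecidableEq V] [Fintype W] [DecidableEq W]

/-- Multiplicativity over arcs: the right-hand side no longer sees how the trail was cut into
cycles. -/
theorem PlaneGraph.IsKasteleyn.decompositionSign_eq {G : PlaneGraph V} (hG : G.IsKasteleyn)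
    {T : Multiset (V × V)} {D : Multiset (Equiv.Perm V)} (hD : IsCompatibleDecomposition T D)
    (hT : ∀ e ∈ T, G.graph.Adj e.1 e.2) :
    G.decompositionSign D = (T.map fun e => G.arcSign e.1 e.2).prod := by
  rw [← hD.2, Multiset.map_bind, Multiset.prod_bind, PlaneGraph.decompositionSign]
  congr 1
  apply Multiset.map_congr rfl
  intro d hd
  rw [hG d (hD.1 d hd), arcs, Multiset.map_map]
  · rfl
  · intro v hv
    apply hT (v, d v)
    rw [← hD.2, Multiset.mem_bind]
    exact ⟨d, hd, Multiset.mem_map.2 ⟨v, hv, rfl⟩⟩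

theorem projDecomposition_spec {X : Type*} [Fintype X] [DecidableEq X] (g : X → V)
    (c : Equiv.Perm X) : IsCompatibleDecomposition (projArcs g c) (projDecomposition g c) :=
  (exists_decomposition g c).choose_spec

theorem PlaneGraph.IsKasteleyn.projSign_eq {X : Type*} [Fintype X] [DecidableEq X]
    {G : PlaneGraph V} (hG : G.IsKasteleyn) (g : X → V) (c : Equiv.Perm X)
    (hc : ∀ v ∈ c.support, g v ≠ g (c v) → G.graph.Adj (g v) (g (c v))) :
    G.decompositionSign (projDecomposition g c) =
      ∏ v ∈ c.support, if g v ≠ g (c v) then G.arcSign (g v) (g (c v)) else 1 := by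
  rw [hG.decompositionSign_eq (projDecomposition_spec g c)]
  · rw [← Finset.prod_filter, projArcs, arcs, Multiset.filter_map, Multiset.map_map,
      Multiset.map_map]
    rfl
  · intro e he
    obtain ⟨e', he', rfl⟩ := Multiset.mem_map.1 he
    obtain ⟨h1, h2⟩ := Multiset.mem_filter.1 he'
    obtain ⟨v, hv, rfl⟩ := Multiset.mem_map.1 h1
    exact hc v hv h2

variable {A : PlaneGraph V} {B : PlaneGraph W}

omit [DecidableEq V] in
theorem PlaneGraph.label_injective (G : PlaneGraph V) : Function.Injective G.label :=
  Set.injOn_univ.1 G.label_bijOn.injOn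

omit [DecidableEq V] in
theorem PlaneGraph.label_mem (G : PlaneGraph V) (v : V) :
    1 ≤ G.label v ∧ G.label v ≤ Fintype.card V :=
  G.label_bijOn.mapsTo (Set.mem_univ v)

/-- The oriented Cartesian product of canonically oriented graphs is canonically oriented by the
boustrophedon labelling of the product. -/
theorem orientedProd_canonical_iff (u v : V × W) :
    orientedProd B A.canonicalOrientation B.canonicalOrientation u v ↔
      (A.graph □ B.graph).Adj u v ∧
        boustrophedon (Fintype.card V) (A.label u.1) (B.label u.2) <
          boustrophedon (Fintype.card V) (A.label v.1) (B.label v.2) := by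
  obtain ⟨u₁, u₂⟩ := u
  obtain ⟨v₁, v₂⟩ := v
  simp only [orientedProd, PlaneGraph.canonicalOrientation, SimpleGraph.boxProd_adj]
  obtain ⟨hu, hu'⟩ := A.label_mem u₁
  obtain ⟨hv, hv'⟩ := A.label_mem v₁
  by_cases h2 : u₂ = v₂
  · subst h2
    rw [boustrophedon_lt_iff hu hu' hv hv' (B.label_mem _).1, A.graph.adj_comm v₁ u₁,
      Nat.even_add_one, Nat.odd_add_one, Nat.not_even_iff_odd, Nat.not_odd_iff_even]
    simp
    tauto
  · by_cases h1 : u₁ = v₁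
    · subst h1
      have hne : B.label u₂ ≠ B.label v₂ := fun h => h2 (B.label_injective h)
      have h3 : boustrophedon (Fintype.card V) (A.label u₁) (B.label u₂) <
          boustrophedon (Fintype.card V) (A.label u₁) (B.label v₂) ↔ B.label u₂ < B.label v₂ := by
        rcases lt_or_gt_of_ne hne with h | h
        · have := boustrophedon_lt_of_lt hu hu' hu hu' (B.label_mem _).1 h
          simp only [h, this]
        · have := boustrophedon_lt_of_lt hu hu' hu hu' (B.label_mem _).1 h
          simp only [h.not_gt, this.not_gt]
      rw [h3]
      simp [h2]
    · simp [h1, h2]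

open Classical in
/-- Along a loop of the product of two graphs with the Kasteleyn property, the sign is determined by
the oriented Cartesian product. -/
theorem loopSign_eq (hA : A.IsKasteleyn) (hB : B.IsKasteleyn) {c : Equiv.Perm (V × W)}
    (hc : ∀ v ∈ c.support, (A.graph □ B.graph).Adj v (c v)) :
    loopSign A B c = -∏ v ∈ c.support,
      if orientedProd B A.canonicalOrientation B.canonicalOrientation v (c v) then 1 else -1 := by
  rw [loopSign, hA.projSign_eq, hB.projSign_eq, numReversed, ← Finset.prod_const,
    Finset.prod_filter, ← Finset.prod_mul_distrib, ← Finset.prod_mul_distrib]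
  · congr 1
    apply Finset.prod_congr rfl
    intro v hv
    have h := hc v hv
    generalize c v = w at h
    obtain ⟨v₁, v₂⟩ := v
    obtain ⟨w₁, w₂⟩ := w
    simp only [orientedProd, PlaneGraph.canonicalOrientation, SimpleGraph.boxProd_adj] at h ⊢
    -- An arc in a copy of `A` contributes its projection sign and possibly the reversal; an arc in
    -- a copy of `B` contributes only its projection sign.
    rcases h with ⟨h, rfl⟩ | ⟨h, rfl⟩
    · have hlt : A.label v₁ < A.label w₁ ↔ ¬ A.label w₁ < A.label v₁ := by
        have : A.label v₁ ≠ A.label w₁ := fun h' => h.ne (A.label_injective h')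
        omega
      by_cases ho : Odd (B.label v₂ + 1)
      · have he := Nat.not_even_iff_odd.2 ho
        by_cases hl : A.label w₁ < A.label v₁ <;>
          simp [h, h.ne, h.symm, ho, he, PlaneGraph.arcSign, hlt, hl]
      · have he := Nat.not_odd_iff_even.1 ho
        by_cases hl : A.label w₁ < A.label v₁ <;>
          simp [h, h.ne, h.symm, ho, he, PlaneGraph.arcSign, hlt, hl]
    · simp [h, h.ne, PlaneGraph.arcSign]
  · intro v hv hne
    have h := hc v hv
    rw [SimpleGraph.boxProd_adj] at h
    rcases h with ⟨h, h'⟩ | ⟨h, h'⟩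
    · exact absurd h' hne
    · exact h
  · intro v hv hne
    have h := hc v hv
    rw [SimpleGraph.boxProd_adj] at h
    rcases h with ⟨h, h'⟩ | ⟨h, h'⟩
    · exact h
    · exact absurd h' hne

/-! ### Transport of the model along an isomorphism preserving the orientation -/

variable {V' W' : Type*} [Fintype V'] [DecidableEq V'] [Fintype W'] [DecidableEq W']
  {A' : PlaneGraph V'} {B' : PlaneGraph W'}

theorem support_permCongr {X Y : Type*} [Fintype X] [DecidableEq X] [Fintype Y] [DecidableEq Y]
    (e : X ≃ Y) (c : Equiv.Perm X) :
    (e.permCongr c).support = c.support.map e.toEmbedding := by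
  ext y
  simp only [Equiv.Perm.mem_support, Equiv.permCongr_apply, Finset.mem_map_equiv, ne_eq,
    ← Equiv.eq_symm_apply]

theorem isCycle_permCongr {X Y : Type*} (e : X ≃ Y) {c : Equiv.Perm X} (hc : c.IsCycle) :
    (e.permCongr c).IsCycle := by
  obtain ⟨x, hx, h⟩ := hc
  refine ⟨e x, by simpa using hx, ?_⟩
  intro y hy
  obtain ⟨k, hk⟩ := @h (e.symm y) (by simpa [← Equiv.eq_symm_apply] using hy)
  refine ⟨k, ?_⟩
  have : e.permCongr c ^ k = e.permCongr (c ^ k) := (map_zpow e.permCongrHom c k).symm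
  rw [this, Equiv.permCongr_apply, Equiv.symm_apply_apply, hk, Equiv.apply_symm_apply]

theorem isEvenLoop_permCongr {X Y : Type*} [Fintype X] [DecidableEq X] [Fintype Y] [DecidableEq Y]
    {P : SimpleGraph X} {Q : SimpleGraph Y} (e : X ≃ Y)
    (he : ∀ u v, Q.Adj (e u) (e v) ↔ P.Adj u v) (c : Equiv.Perm X) :
    IsEvenLoop Q (e.permCongr c) ↔ IsEvenLoop P c := by
  have hcyc : (e.permCongr c).IsCycle ↔ c.IsCycle := by
    refine ⟨fun h => ?_, isCycle_permCongr e⟩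
    have := isCycle_permCongr e.symm h
    rwa [← Equiv.permCongr_symm, Equiv.symm_apply_apply] at this
  rw [IsEvenLoop, IsEvenLoop, hcyc, support_permCongr, Finset.card_map]
  simp only [Finset.forall_mem_map, Equiv.coe_toEmbedding, Equiv.permCongr_apply,
    Equiv.symm_apply_apply, he]

theorem isConfiguration_map {X Y : Type*} [Fintype X] [DecidableEq X] [Fintype Y] [DecidableEq Y]
    {P : SimpleGraph X} {Q : SimpleGraph Y} (e : X ≃ Y)
    (he : ∀ u v, Q.Adj (e u) (e v) ↔ P.Adj u v) (C : Finset (Equiv.Perm X)) :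
    IsConfiguration Q (C.map e.permCongr.toEmbedding) ↔ IsConfiguration P C := by
  unfold IsConfiguration
  simp only [Finset.forall_mem_map, Equiv.coe_toEmbedding, isEvenLoop_permCongr e he,
    support_permCongr, Finset.disjoint_map, ne_eq, EmbeddingLike.apply_eq_iff_eq]

/-- Conjugation by `e` matches configurations, and by `loopSign_eq` the sign of a loop is read off
the orientation, which `e` preserves. The two factorisations need not correspond. -/
theorem partitionFunction_eq_of_iso (hA : A.IsKasteleyn) (hB : B.IsKasteleyn)
    (hA' : A'.IsKasteleyn) (hB' : B'.IsKasteleyn) (e : V × W ≃ V' × W')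
    (hadj : ∀ u v, (A'.graph □ B'.graph).Adj (e u) (e v) ↔ (A.graph □ B.graph).Adj u v)
    (he : ∀ u v, orientedProd B A.canonicalOrientation B.canonicalOrientation u v ↔
      orientedProd B' A'.canonicalOrientation B'.canonicalOrientation (e u) (e v))
    {R : Type*} [CommRing R] (x : V × W → R) (a : Sym2 (V × W) → R) :
    partitionFunction A B x a =
      partitionFunction A' B' (x ∘ e.symm) (a ∘ Sym2.map e.symm) := by
  classical
  unfold partitionFunction
  apply Finset.sum_equiv (Equiv.finsetCongr e.permCongr)
  · intro C
    simp only [Finset.mem_filter, Finset.mem_univ, true_and, Equiv.finsetCongr_apply]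
    exact (isConfiguration_map e hadj C).symm
  · intro C hC
    have hC' := (Finset.mem_filter.1 hC).2
    rw [Equiv.finsetCongr_apply, configWeight, configWeight, Finset.prod_map]
    congr 1
    · apply Finset.prod_congr rfl
      intro c hc
      have hc₁ := (hC'.1 c hc).2.2
      have hc₂ := ((isEvenLoop_permCongr e hadj c).2 (hC'.1 c hc)).2.2
      rw [Equiv.coe_toEmbedding, loopWeight, loopWeight, loopSign_eq hA hB hc₁,
        loopSign_eq hA' hB' hc₂, support_permCongr, Finset.prod_map, Finset.prod_map]
      congr 3
      · congr 2
        funext v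
        simp [Equiv.permCongr_apply, he]
      · simp [Equiv.permCongr_apply]
    · have hsupp : (Finset.univ \ (C.map e.permCongr.toEmbedding).biUnion
          Equiv.Perm.support) =
          (Finset.univ \ C.biUnion Equiv.Perm.support).map e.toEmbedding := by
        ext y
        obtain ⟨v, rfl⟩ := e.surjective y
        simp only [Finset.mem_sdiff, Finset.mem_univ, true_and, Finset.mem_biUnion, Finset.mem_map,
          exists_exists_and_eq_and, Equiv.coe_toEmbedding, support_permCongr,
          EmbeddingLike.apply_eq_iff_eq, exists_eq_right]
      rw [hsupp, Finset.prod_map]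
      simp

end Product

/-! ### The three-dimensional boustrophedon label as an iterated plane label -/

theorem boustrophedon_odd (ℓ p s : ℕ) : boustrophedon ℓ p (2 * s + 1) = 2 * s * ℓ + p := by
  rw [boustrophedon, if_pos (odd_two_mul_add_one s), show (2 * s + 1) / 2 = s by omega]

theorem boustrophedon_even {ℓ p : ℕ} (hp : p ≤ ℓ) (s : ℕ) :
    (boustrophedon ℓ p (2 * (s + 1)) : ℤ) = 2 * (s + 1) * ℓ + 1 - p := by
  rw [boustrophedon, if_neg (by simp), Nat.mul_div_cancel_left _ two_pos, Nat.cast_sub]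
  · push_cast
    ring
  · have : 2 * (s + 1) * ℓ = 2 * s * ℓ + ℓ + ℓ := by ring
    omega

theorem nat_parity_cases {q : ℕ} (hq : 1 ≤ q) :
    (∃ s, q = 2 * s + 1) ∨ ∃ s, q = 2 * (s + 1) := by
  rcases Nat.even_or_odd' q with ⟨s, rfl | rfl⟩
  · exact Or.inr ⟨s - 1, by omega⟩
  · exact Or.inl ⟨s, rfl⟩

theorem boustrophedon₃_odd (ℓ m p q : ℤ) (t : ℕ) :
    boustrophedon₃ ℓ m p q ((2 * t + 1 : ℕ) : ℤ) =
      if Odd q then 2 * t * ℓ * m + 2 * (q / 2) * ℓ + p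
      else 2 * t * ℓ * m + 2 * (q / 2) * ℓ - p + 1 := by
  rw [boustrophedon₃, if_pos (by exact_mod_cast odd_two_mul_add_one t),
    show (((2 * t + 1 : ℕ) : ℤ)) / 2 = t by omega]

theorem boustrophedon₃_even (ℓ m p q : ℤ) (t : ℕ) :
    boustrophedon₃ ℓ m p q ((2 * (t + 1) : ℕ) : ℤ) =
      if Odd q then 2 * (t + 1) * ℓ * m - 2 * (q / 2) * ℓ - p + 1
      else 2 * (t + 1) * ℓ * m - 2 * (q / 2) * ℓ + p := by
  rw [boustrophedon₃, if_neg (by rw [Int.odd_coe_nat]; simp),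
    show (((2 * (t + 1) : ℕ) : ℤ)) / 2 = t + 1 by omega]

theorem boustrophedon₃_eq_fst {ℓ m p q r : ℕ} (hp : 1 ≤ p) (hp' : p ≤ ℓ) (hq : 1 ≤ q)
    (hq' : q ≤ m) (hr : 1 ≤ r) :
    boustrophedon₃ ℓ m p q r = (boustrophedon (ℓ * m) (boustrophedon ℓ p q) r : ℕ) := by
  have h1 := (boustrophedon_mem hp hp' q hq).2
  have h2 : q * ℓ ≤ m * ℓ := Nat.mul_le_mul_right _ hq'
  -- Plane labels stay within one layer, so reversing them in an even layer does not truncate.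
  have h3 : boustrophedon ℓ p q ≤ ℓ * m := by rw [mul_comm ℓ m]; omega
  rcases nat_parity_cases hr with ⟨t, rfl⟩ | ⟨t, rfl⟩
  · rw [boustrophedon₃_odd, boustrophedon_odd]
    rcases nat_parity_cases hq with ⟨s, rfl⟩ | ⟨s, rfl⟩
    · rw [if_pos (by exact_mod_cast odd_two_mul_add_one s), boustrophedon_odd,
        show (((2 * s + 1 : ℕ) : ℤ)) / 2 = s by omega]
      push_cast
      ring
    · rw [if_neg (by rw [Int.odd_coe_nat]; simp), Nat.cast_add, boustrophedon_even hp',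
        show (((2 * (s + 1) : ℕ) : ℤ)) / 2 = s + 1 by omega]
      push_cast
      ring
  · rw [boustrophedon₃_even, boustrophedon_even h3]
    rcases nat_parity_cases hq with ⟨s, rfl⟩ | ⟨s, rfl⟩
    · rw [if_pos (by exact_mod_cast odd_two_mul_add_one s), boustrophedon_odd,
        show (((2 * s + 1 : ℕ) : ℤ)) / 2 = s by omega]
      push_cast
      ring
    · rw [if_neg (by rw [Int.odd_coe_nat]; simp), boustrophedon_even hp',
        show (((2 * (s + 1) : ℕ) : ℤ)) / 2 = s + 1 by omega]
      push_cast
      ring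

/-- In an even layer the plane label of `(q, r)` has parity opposite to `q`, which is why the
direction of `p` there is the reverse of that in odd layers. -/
theorem boustrophedon₃_eq_snd {ℓ m p q r : ℕ} (hp' : p ≤ ℓ) (hq : 1 ≤ q)
    (hq' : q ≤ m) (hr : 1 ≤ r) :
    boustrophedon₃ ℓ m p q r = (boustrophedon ℓ p (boustrophedon m q r) : ℕ) := by
  rcases nat_parity_cases hr with ⟨t, rfl⟩ | ⟨t, rfl⟩
  · rw [boustrophedon₃_odd, boustrophedon_odd]
    rcases nat_parity_cases hq with ⟨s, rfl⟩ | ⟨s, rfl⟩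
    · rw [if_pos (by exact_mod_cast odd_two_mul_add_one s),
        show 2 * t * m + (2 * s + 1) = 2 * (t * m + s) + 1 by ring, boustrophedon_odd,
        show (((2 * s + 1 : ℕ) : ℤ)) / 2 = s by omega]
      push_cast
      ring
    · rw [if_neg (by rw [Int.odd_coe_nat]; simp),
        show 2 * t * m + 2 * (s + 1) = 2 * (t * m + s + 1) by ring, boustrophedon_even hp',
        show (((2 * (s + 1) : ℕ) : ℤ)) / 2 = s + 1 by omega]
      push_cast
      ring
  · have hb := boustrophedon_even hq' t
    rw [boustrophedon₃_even]
    have hm : m ≤ (t + 1) * m := Nat.le_mul_of_pos_left _ (by omega)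
    rcases nat_parity_cases hq with ⟨s, rfl⟩ | ⟨s, rfl⟩
    · obtain ⟨k, hk⟩ : ∃ k, (t + 1) * m = k + s + 1 := ⟨(t + 1) * m - s - 1, by omega⟩
      have hkz : ((t : ℤ) + 1) * m = k + s + 1 := by exact_mod_cast hk
      have hb' : boustrophedon m (2 * s + 1) (2 * (t + 1)) = 2 * (k + 1) := by
        zify
        rw [hb]
        push_cast
        linear_combination 2 * hkz
      rw [hb', if_pos (by exact_mod_cast odd_two_mul_add_one s), boustrophedon_even hp',
        show (((2 * s + 1 : ℕ) : ℤ)) / 2 = s by omega]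
      linear_combination 2 * (ℓ : ℤ) * hkz
    · obtain ⟨k, hk⟩ : ∃ k, (t + 1) * m = k + s + 1 := ⟨(t + 1) * m - s - 1, by omega⟩
      have hkz : ((t : ℤ) + 1) * m = k + s + 1 := by exact_mod_cast hk
      have hb' : boustrophedon m (2 * (s + 1)) (2 * (t + 1)) = 2 * k + 1 := by
        zify
        rw [hb]
        push_cast
        linear_combination 2 * hkz
      rw [hb', if_neg (by rw [Int.odd_coe_nat]; simp), boustrophedon_odd,
        show (((2 * (s + 1) : ℕ) : ℤ)) / 2 = s + 1 by omega]
      push_cast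
      linear_combination 2 * (ℓ : ℤ) * hkz

theorem orientedProd_grid_path_iff {ℓ m n : ℕ} (u v : (Fin ℓ × Fin m) × Fin n) :
    orientedProd (path n) (grid ℓ m).canonicalOrientation (path n).canonicalOrientation u v ↔
      ((grid ℓ m).graph □ (path n).graph).Adj u v ∧
        boustrophedon₃ ℓ m (u.1.1.val + 1) (u.1.2.val + 1) (u.2.val + 1) <
          boustrophedon₃ ℓ m (v.1.1.val + 1) (v.1.2.val + 1) (v.2.val + 1) := by
  have key : ∀ w : (Fin ℓ × Fin m) × Fin n,
      boustrophedon₃ ℓ m (w.1.1.val + 1) (w.1.2.val + 1) (w.2.val + 1) =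
        (boustrophedon (Fintype.card (Fin ℓ × Fin m)) ((grid ℓ m).label w.1)
          ((path n).label w.2) : ℕ) := by
    intro w
    rw [Fintype.card_prod, Fintype.card_fin, Fintype.card_fin]
    have := boustrophedon₃_eq_fst (ℓ := ℓ) (m := m) (p := w.1.1.val + 1) (q := w.1.2.val + 1)
      (r := w.2.val + 1) (by omega) w.1.1.isLt (by omega) w.1.2.isLt (by omega)
    exact_mod_cast this
  rw [orientedProd_canonical_iff, key, key, Nat.cast_lt]

theorem orientedProd_path_grid_iff {ℓ m n : ℕ} (u v : Fin ℓ × (Fin m × Fin n)) :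
    orientedProd (grid m n) (path ℓ).canonicalOrientation (grid m n).canonicalOrientation u v ↔
      ((path ℓ).graph □ (grid m n).graph).Adj u v ∧
        boustrophedon₃ ℓ m (u.1.val + 1) (u.2.1.val + 1) (u.2.2.val + 1) <
          boustrophedon₃ ℓ m (v.1.val + 1) (v.2.1.val + 1) (v.2.2.val + 1) := by
  have key : ∀ w : Fin ℓ × (Fin m × Fin n),
      boustrophedon₃ ℓ m (w.1.val + 1) (w.2.1.val + 1) (w.2.2.val + 1) =
        (boustrophedon (Fintype.card (Fin ℓ)) ((path ℓ).label w.1)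
          ((grid m n).label w.2) : ℕ) := by
    intro w
    rw [Fintype.card_fin]
    have := boustrophedon₃_eq_snd (ℓ := ℓ) (m := m) (p := w.1.val + 1) (q := w.2.1.val + 1)
      (r := w.2.2.val + 1) w.1.isLt (by omega) w.2.1.isLt (by omega)
    exact_mod_cast this
  rw [orientedProd_canonical_iff, key, key, Nat.cast_lt]

theorem adj_prodAssoc {ℓ m n : ℕ} (u v : (Fin ℓ × Fin m) × Fin n) :
    ((path ℓ).graph □ (grid m n).graph).Adj (Equiv.prodAssoc _ _ _ u) (Equiv.prodAssoc _ _ _ v) ↔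
      ((grid ℓ m).graph □ (path n).graph).Adj u v := by
  change (SimpleGraph.pathGraph ℓ □ (SimpleGraph.pathGraph m □ SimpleGraph.pathGraph n)).Adj _ _ ↔
    ((SimpleGraph.pathGraph ℓ □ SimpleGraph.pathGraph m) □ SimpleGraph.pathGraph n).Adj _ _
  simp only [SimpleGraph.boxProd_adj, Equiv.prodAssoc_apply, Prod.ext_iff]
  tauto

end MonopoleDimer

theorem mainTheorem7 {R : Type*} [CommRing R] (ℓ m n : ℕ)
    (x : (Fin ℓ × Fin m) × Fin n → R) (a : Sym2 ((Fin ℓ × Fin m) × Fin n) → R) :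
    -- both oriented products are canonically oriented by the same boustrophedon labelling
    (∀ u v : (Fin ℓ × Fin m) × Fin n,
      (MonopoleDimer.orientedProd (MonopoleDimer.path n)
          (MonopoleDimer.grid ℓ m).canonicalOrientation
          (MonopoleDimer.path n).canonicalOrientation u v ↔
        ((MonopoleDimer.grid ℓ m).graph □ (MonopoleDimer.path n).graph).Adj u v ∧
          MonopoleDimer.boustrophedon₃ ℓ m (u.1.1.val + 1) (u.1.2.val + 1) (u.2.val + 1) <
            MonopoleDimer.boustrophedon₃ ℓ m (v.1.1.val + 1) (v.1.2.val + 1) (v.2.val + 1))) ∧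
    (∀ u v : Fin ℓ × (Fin m × Fin n),
      (MonopoleDimer.orientedProd (MonopoleDimer.grid m n)
          (MonopoleDimer.path ℓ).canonicalOrientation
          (MonopoleDimer.grid m n).canonicalOrientation u v ↔
        ((MonopoleDimer.path ℓ).graph □ (MonopoleDimer.grid m n).graph).Adj u v ∧
          MonopoleDimer.boustrophedon₃ ℓ m (u.1.val + 1) (u.2.1.val + 1) (u.2.2.val + 1) <
            MonopoleDimer.boustrophedon₃ ℓ m (v.1.val + 1) (v.2.1.val + 1) (v.2.2.val + 1))) ∧
    -- the two partition functions agree, for all vertex weights `x` and edge weights `a`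
    MonopoleDimer.partitionFunction (MonopoleDimer.grid ℓ m) (MonopoleDimer.path n) x a =
      MonopoleDimer.partitionFunction (MonopoleDimer.path ℓ) (MonopoleDimer.grid m n)
        (x ∘ (Equiv.prodAssoc (Fin ℓ) (Fin m) (Fin n)).symm)
        (a ∘ Sym2.map (Equiv.prodAssoc (Fin ℓ) (Fin m) (Fin n)).symm) := by
  refine ⟨MonopoleDimer.orientedProd_grid_path_iff, MonopoleDimer.orientedProd_path_grid_iff, ?_⟩
  apply MonopoleDimer.partitionFunction_eq_of_iso (MonopoleDimer.isKasteleyn_grid ℓ m)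
    (MonopoleDimer.isKasteleyn_path n) (MonopoleDimer.isKasteleyn_path ℓ)
    (MonopoleDimer.isKasteleyn_grid m n) (Equiv.prodAssoc (Fin ℓ) (Fin m) (Fin n))
    MonopoleDimer.adj_prodAssoc
  intro u v
  rw [MonopoleDimer.orientedProd_grid_path_iff, MonopoleDimer.orientedProd_path_grid_iff,
    MonopoleDimer.adj_prodAssoc]
  rfl
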